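/- Theorem 1.1. Let $n\ge 1$, let $U\subseteq\mathbb C^n$ be a connected nonempty open set, and let $F:U\to\mathbb R$ be a smooth function that depends only on $|z|^2=|z_1|^2+\cdots+|z_n|^2$, such that the Hermitian matrix $g_{i\bar j}=\partial^2F/\partial z_i\partial\bar z_j$ is positive definite at every point of $U$ (so that $F$ is the potential of a radial Kähler metric $g$ on $U$). If the scalar curvature $\rho$ of $g$ is constant on $U$, then the function $a_3$ is constant on $U$ if and only if the function $a_2$ is constant on $U$. Here $a_2$ and $a_3$ are the second and third Tian–Yau–Zelditch coefficients of $g$, defined by Lu's formulas $$a_2=\tfrac13\Delta\rho+\tfrac1{24}\left(|R|^2-4|\mathrm{Ric}|^2+3\rho^2\right),$$ $$a_3=\tfrac18\Delta\Delta\rho+\tfrac1{24}\,\mathrm{div}\,\mathrm{div}(R,\mathrm{Ric})-\tfrac16\,\mathrm{div}\,\mathrm{div}(\rho\,\mathrm{Ric})+\tfrac1{48}\Delta\left(|R|^2-4|\mathrm{Ric}|^2+8\rho^2\right)+\tfrac1{48}\rho\left(\rho^2-4|\mathrm{Ric}|^2+|R|^2\right)+\tfrac1{24}\left(\sigma_3(\mathrm{Ric})-\mathrm{Ric}(R,R)-R(\mathrm{Ric},\mathrm{Ric})\right),$$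 with the following notation (repeated indices are summed, and $g^{i\bar j}$ is defined by $g_{k\bar j}g^{i\bar j}=\delta_{ki}$): $$\Gamma_{ki}^p=g^{p\bar q}\frac{\partial g_{i\bar q}}{\partial z_k},\qquad R_{i\bar jk\bar l}=\frac{\partial^2g_{i\bar l}}{\partial z_k\partial\bar z_j}-g^{q\bar p}\frac{\partial g_{i\bar p}}{\partial z_k}\frac{\partial g_{q\bar l}}{\partial\bar z_j},\qquad \mathrm{Ric}_{i\bar j}=-\frac{\partial^2\log\det g}{\partial z_i\partial\bar z_j},$$ $$\rho=g^{i\bar j}\mathrm{Ric}_{i\bar j},\qquad \Delta u=g^{i\bar j}\frac{\partial^2u}{\partial z_i\partial\bar z_j},$$ $$\mathrm{Ric}_{i\bar j,k}=\partial_{z_k}\mathrm{Ric}_{i\bar j}-\Gamma_{ki}^p\mathrm{Ric}_{p\bar j},\qquad \mathrm{Ric}_{i\bar j,k\bar l}=\partial_{\bar z_l}\mathrm{Ric}_{i\bar j,k}-\overline{\Gamma_{lj}^p}\,\mathrm{Ric}_{i\bar p,k},$$ $$|R|^2=g^{i\bar\alpha}g^{\beta\bar j}g^{k\bar\gamma}g^{\delta\bar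 l}R_{i\bar jk\bar l}\overline{R_{\alpha\bar\beta\gamma\bar\delta}},\qquad |\mathrm{Ric}|^2=g^{i\bar\alpha}g^{\beta\bar j}\mathrm{Ric}_{i\bar j}\overline{\mathrm{Ric}_{\alpha\bar\beta}},$$ $$|D'\rho|^2=g^{i\bar j}\frac{\partial\rho}{\partial z_i}\frac{\partial\rho}{\partial\bar z_j},\qquad |D'\mathrm{Ric}|^2=g^{i\bar\alpha}g^{\beta\bar j}g^{k\bar\gamma}\mathrm{Ric}_{i\bar j,k}\overline{\mathrm{Ric}_{\alpha\bar\beta,\gamma}},$$ $$\sigma_3(\mathrm{Ric})=g^{i\bar\delta}g^{\alpha\bar j}g^{\gamma\bar\beta}\mathrm{Ric}_{i\bar j}\mathrm{Ric}_{\alpha\bar\beta}\mathrm{Ric}_{\gamma\bar\delta},\qquad R(\mathrm{Ric},\mathrm{Ric})=g^{i\bar\alpha}g^{\beta\bar j}g^{k\bar\gamma}g^{\delta\bar l}R_{i\bar jk\bar l}\mathrm{Ric}_{\beta\bar\alpha}\mathrm{Ric}_{\delta\bar\gamma},$$ $$\mathrm{Ric}(R,R)=g^{i\bar\alpha}g^{\beta\bar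 j}g^{k\bar\gamma}g^{p\bar\delta}g^{\varepsilon\bar q}\mathrm{Ric}_{i\bar j}R_{\beta\bar\gamma p\bar q}R_{k\bar\alpha\varepsilon\bar\delta},$$ $$\mathrm{div}\,\mathrm{div}(\rho\,\mathrm{Ric})=2|D'\rho|^2+g^{i\bar\beta}g^{\alpha\bar j}\mathrm{Ric}_{i\bar j}\frac{\partial^2\rho}{\partial z_\alpha\partial\bar z_\beta}+\rho\,\Delta\rho,$$ $$\mathrm{div}\,\mathrm{div}(R,\mathrm{Ric})=-g^{i\bar\beta}g^{\alpha\bar j}\mathrm{Ric}_{i\bar j}\frac{\partial^2\rho}{\partial z_\alpha\partial\bar z_\beta}-2|D'\mathrm{Ric}|^2+g^{i\bar\alpha}g^{\beta\bar j}g^{k\bar\gamma}g^{\delta\bar l}\mathrm{Ric}_{i\bar j,k\bar l}R_{\beta\bar\alpha\delta\bar\gamma}-R(\mathrm{Ric},\mathrm{Ric})-\sigma_3(\mathrm{Ric}).$$ -/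

import Mathlib

open scoped ComplexConjugate ComplexOrder ContDiff

namespace TYZ

noncomputable section

/-- The Wirtinger derivative `∂f/∂z_i = (∂f/∂x_i - √-1 ∂f/∂y_i)/2`, where `z_i = x_i + √-1 y_i`. -/
def dz {n : ℕ} (i : Fin n) (f : (Fin n → ℂ) → ℂ) (z : Fin n → ℂ) : ℂ :=
  (1 / 2 : ℂ) *
    (fderiv ℝ f z (Pi.single i 1) - Complex.I * fderiv ℝ f z (Pi.single i Complex.I))

/-- The Wirtinger derivative `∂f/∂z̄_i = (∂f/∂x_i + √-1 ∂f/∂y_i)/2`. -/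
def dzbar {n : ℕ} (i : Fin n) (f : (Fin n → ℂ) → ℂ) (z : Fin n → ℂ) : ℂ :=
  (1 / 2 : ℂ) *
    (fderiv ℝ f z (Pi.single i 1) + Complex.I * fderiv ℝ f z (Pi.single i Complex.I))

/-- The matrix `g_{i j̄} = ∂²F/∂z_i∂z̄_j` of the metric with potential `F`. -/
def metric {n : ℕ} (F : (Fin n → ℂ) → ℝ) (z : Fin n → ℂ) : Matrix (Fin n) (Fin n) ℂ :=
  Matrix.of fun i j => dz i (dzbar j fun w => (F w : ℂ)) z

/-- `F` depends only on `|z|² = |z_1|² + ⋯ + |z_n|²` on the set `U`. -/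
def IsRadialOn {n : ℕ} (U : Set (Fin n → ℂ)) (F : (Fin n → ℂ) → ℝ) : Prop :=
  ∃ f : ℝ → ℝ, ∀ z ∈ U, F z = f (∑ i, ‖z i‖ ^ 2)

/-- `F` is a smooth potential of a (positive definite) Kähler metric on `U`. -/
def IsKahlerPotentialOn {n : ℕ} (U : Set (Fin n → ℂ)) (F : (Fin n → ℂ) → ℝ) : Prop :=
  ContDiffOn ℝ ∞ F U ∧ ∀ z ∈ U, (metric F z).PosDef

/-- `u` is constant on `U`. -/
def IsConstantOn {n : ℕ} (U : Set (Fin n → ℂ)) (u : (Fin n → ℂ) → ℂ) : Prop :=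
  ∃ c : ℂ, ∀ z ∈ U, u z = c

/-! In what follows `g` is the coefficient matrix `g_{i j̄}` of a Kähler metric, as a function
of the point.  Unbarred lower indices are contracted with unbarred upper ones, and barred with
barred.  The order of the arguments of a tensor component is that of its indices. -/

variable {n : ℕ} (g : (Fin n → ℂ) → Matrix (Fin n) (Fin n) ℂ)

/-- `g^{i j̄}`, normalised by `∑_j g_{k j̄} g^{i j̄} = δ_{k i}`. -/
def ginv (i j : Fin n) (z : Fin n → ℂ) : ℂ := (g z)⁻¹ j i

/-- Christoffel symbols `Γ_{k i}^p = g^{p q̄} ∂g_{i q̄}/∂z_k`. -/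
def christoffel (k i p : Fin n) (z : Fin n → ℂ) : ℂ :=
  ∑ q, ginv g p q z * dz k (fun w => g w i q) z

/-- Curvature tensor
`R_{i j̄ k l̄} = ∂²g_{i l̄}/∂z_k∂z̄_j - g^{q p̄} ∂g_{i p̄}/∂z_k ∂g_{q l̄}/∂z̄_j`. -/
def curv (i j k l : Fin n) (z : Fin n → ℂ) : ℂ :=
  dz k (dzbar j fun w => g w i l) z -
    ∑ p, ∑ q, ginv g q p z * dz k (fun w => g w i p) z * dzbar j (fun w => g w q l) z

/-- Ricci tensor `Ric_{i j̄} = -∂² log det g / ∂z_i∂z̄_j`. -/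
def ric (i j : Fin n) (z : Fin n → ℂ) : ℂ :=
  -dz i (dzbar j fun w => Complex.log (g w).det) z

/-- Scalar curvature `ρ = g^{i j̄} Ric_{i j̄}`. -/
def scal (z : Fin n → ℂ) : ℂ :=
  ∑ i, ∑ j, ginv g i j z * ric g i j z

/-- Laplacian `Δu = g^{i j̄} ∂²u/∂z_i∂z̄_j`. -/
def lap (u : (Fin n → ℂ) → ℂ) (z : Fin n → ℂ) : ℂ :=
  ∑ i, ∑ j, ginv g i j z * dz i (dzbar j u) z

/-- `Ric_{i j̄, k}`: covariant derivative of the Ricci tensor in the direction `∂/∂z_k`. -/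
def ricD (i j k : Fin n) (z : Fin n → ℂ) : ℂ :=
  dz k (ric g i j) z - ∑ p, christoffel g k i p z * ric g p j z

/-- `Ric_{i j̄, k l̄}`: covariant derivative of `Ric_{i j̄, k}` in the direction `∂/∂z̄_l`. -/
def ricDD (i j k l : Fin n) (z : Fin n → ℂ) : ℂ :=
  dzbar l (ricD g i j k) z - ∑ p, conj (christoffel g l j p z) * ricD g i p k z

/-- `|R|²`. -/
def normSqCurv (z : Fin n → ℂ) : ℂ :=
  ∑ i, ∑ j, ∑ k, ∑ l, ∑ a, ∑ b, ∑ c, ∑ d,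
    ginv g i a z * ginv g b j z * ginv g k c z * ginv g d l z *
      curv g i j k l z * conj (curv g a b c d z)

/-- `|Ric|²`. -/
def normSqRic (z : Fin n → ℂ) : ℂ :=
  ∑ i, ∑ j, ∑ a, ∑ b, ginv g i a z * ginv g b j z * ric g i j z * conj (ric g a b z)

/-- `|D'ρ|²`. -/
def normSqDScal (z : Fin n → ℂ) : ℂ :=
  ∑ i, ∑ j, ginv g i j z * dz i (scal g) z * dzbar j (scal g) z

/-- `|D'Ric|²`. -/
def normSqDRic (z : Fin n → ℂ) : ℂ :=
  ∑ i, ∑ j, ∑ k, ∑ a, ∑ b, ∑ c,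
    ginv g i a z * ginv g b j z * ginv g k c z * ricD g i j k z * conj (ricD g a b c z)

/-- `g^{i β̄} g^{α j̄} Ric_{i j̄} ∂²ρ/∂z_α∂z̄_β`. -/
def ricHessScal (z : Fin n → ℂ) : ℂ :=
  ∑ i, ∑ j, ∑ a, ∑ b,
    ginv g i b z * ginv g a j z * ric g i j z * dz a (dzbar b (scal g)) z

/-- `σ₃(Ric)`. -/
def sigma3 (z : Fin n → ℂ) : ℂ :=
  ∑ i, ∑ j, ∑ a, ∑ b, ∑ c, ∑ d,
    ginv g i d z * ginv g a j z * ginv g c b z * ric g i j z * ric g a b z * ric g c d z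

/-- `R(Ric, Ric)`. -/
def curvRicRic (z : Fin n → ℂ) : ℂ :=
  ∑ i, ∑ j, ∑ k, ∑ l, ∑ a, ∑ b, ∑ c, ∑ d,
    ginv g i a z * ginv g b j z * ginv g k c z * ginv g d l z *
      curv g i j k l z * ric g b a z * ric g d c z

/-- `Ric(R, R)`. -/
def ricCurvCurv (z : Fin n → ℂ) : ℂ :=
  ∑ i, ∑ j, ∑ k, ∑ p, ∑ q, ∑ a, ∑ b, ∑ c, ∑ d, ∑ e,
    ginv g i a z * ginv g b j z * ginv g k c z * ginv g p d z * ginv g e q z *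
      ric g i j z * curv g b c p q z * curv g k a e d z

/-- `div div (ρ Ric)`. -/
def divdivScalRic (z : Fin n → ℂ) : ℂ :=
  2 * normSqDScal g z + ricHessScal g z + scal g z * lap g (scal g) z

/-- `div div (R, Ric)`. -/
def divdivCurvRic (z : Fin n → ℂ) : ℂ :=
  -ricHessScal g z - 2 * normSqDRic g z +
    (∑ i, ∑ j, ∑ k, ∑ l, ∑ a, ∑ b, ∑ c, ∑ d,
      ginv g i a z * ginv g b j z * ginv g k c z * ginv g d l z *
        ricDD g i j k l z * curv g b a d c z) -
    curvRicRic g z - sigma3 g z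

/-- The second coefficient
`a₂ = Δρ/3 + (|R|² - 4|Ric|² + 3ρ²)/24`. -/
def a2 (z : Fin n → ℂ) : ℂ :=
  1 / 3 * lap g (scal g) z +
    1 / 24 * (normSqCurv g z - 4 * normSqRic g z + 3 * scal g z ^ 2)

/-- The third coefficient, by Lu's formula. -/
def a3 (z : Fin n → ℂ) : ℂ :=
  1 / 8 * lap g (lap g (scal g)) z + 1 / 24 * divdivCurvRic g z - 1 / 6 * divdivScalRic g z +
    1 / 48 * lap g (fun w => normSqCurv g w - 4 * normSqRic g w + 8 * scal g w ^ 2) z +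
    1 / 48 * scal g z * (scal g z ^ 2 - 4 * normSqRic g z + normSqCurv g z) +
    1 / 24 * (sigma3 g z - ricCurvCurv g z - curvRicRic g z)

end

end TYZ

/-!
Away from the origin and in dimension `n = m + 1 ≥ 2`, a radial Kähler metric with potential
`F = f(x)`, `x = |z|²`, is described by its momentum coordinate `y = x f'(x)`. Write
`w = x y' / y` and `s = (w - 1) / y`. If the scalar curvature is constant, equal to
`(m + 1)(m + 2) κ`, then the fourth order equation for `f` integrates to `s = X + Y - κ` with
`x X' = -(m + 1) w X` and `x Y' = -(m + 2) w Y`, that is, `X = C y ^ (-(m + 1))` and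
`Y = D y ^ (-(m + 2))` on every connected set of values of `x` (`Profile`, `exists_isNormalForm`,
`Profile.exists_first_integral`).

The Ricci tensor, the curvature tensor and the second covariant derivative of the Ricci tensor are
invariant under the unitary transformations fixing `z`. With indices raised they are therefore
built from the projections `P` and `Q` onto the radial direction and onto its complement, and the
coefficients turn out to be polynomials in `X`, `Y`, `κ` and `1 / y`. Contracting them
(`sum_eight_eq_trace_pair`, `IsProjPair.pair_tensorK`) gives, up to additive constants and a
common positive factor, `24 a₂ = quad` and `48 a₃ = cubic` with
`quad = (m - 1) X² + 2 (m + 1) X Y + (m + 3) Y²`, and with a polynomial `cubic` whose terms of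
degree three are `2 (m + 1) (m - 1) (2 m + 3) X³ + ⋯ + 2 (m + 2) (m + 3) (2 m + 5) Y³`
(`IsNormalForm.a2_eq`, `IsNormalForm.a3_eq`).

Now `1 / y` takes infinitely many values, so that a polynomial in `1 / y` is constant only if its
coefficients vanish. If `quad` or `cubic` is constant, the coefficient of the highest power of
`1 / y`, which comes from `Y²` or `Y³`, forces `D = 0`; what remains has leading coefficient a
positive multiple of `(m - 1) C²` or `(m - 1) C³`, whence `(m - 1) C = 0`. Conversely
`D = 0 = (m - 1) C` makes both `quad` and `cubic` vanish
(`Profile.quad_const_iff_cubic_const`).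

The origin, where these coordinates degenerate, is dealt with by continuity of `a₂` and `a₃`. In
dimension one the curvature is determined by the scalar curvature, and both coefficients are
constant (`const_of_dim_one`).
-/

namespace TYZ

noncomputable section

/-! ### Wirtinger calculus -/

/-- `f` is real differentiable at `z`, with Wirtinger derivatives `∂f/∂z_i = p i` and
`∂f/∂z̄_i = q i`. -/
structure HasWirtinger {n : ℕ} (f : (Fin n → ℂ) → ℂ) (p q : Fin n → ℂ) (z : Fin n → ℂ) :
    Prop where
  differentiableAt : DifferentiableAt ℝ f z
  dz_eq : ∀ i, dz i f z = p i
  dzbar_eq : ∀ i, dzbar i f z = q i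

/-- The squared norm `|z|²`. -/
def nsq {n : ℕ} (z : Fin n → ℂ) : ℝ := ∑ i, ‖z i‖ ^ 2

section Wirtinger

variable {n : ℕ} {f g : (Fin n → ℂ) → ℂ} {p q p' q' : Fin n → ℂ} {z : Fin n → ℂ}

theorem dz_congr {i : Fin n} (h : f =ᶠ[nhds z] g) : dz i f z = dz i g z := by
  simp only [dz, h.fderiv_eq]

theorem dzbar_congr {i : Fin n} (h : f =ᶠ[nhds z] g) : dzbar i f z = dzbar i g z := by
  simp only [dzbar, h.fderiv_eq]

namespace HasWirtinger

theorem congr (h : HasWirtinger f p q z) (hp : p = p') (hq : q = q') :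
    HasWirtinger f p' q' z := by
  subst hp hq; exact h

theorem of_eventuallyEq (h : HasWirtinger f p q z) (hg : g =ᶠ[nhds z] f) :
    HasWirtinger g p q z :=
  ⟨hg.differentiableAt_iff.2 h.1, fun i => (dz_congr hg).trans (h.2 i),
    fun i => (dzbar_congr hg).trans (h.3 i)⟩

theorem const (c : ℂ) : HasWirtinger (fun _ => c) (fun _ => 0) (fun _ => 0) z :=
  ⟨differentiableAt_const c, fun i => by simp [dz], fun i => by simp [dzbar]⟩

theorem add (hf : HasWirtinger f p q z) (hg : HasWirtinger g p' q' z) :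
    HasWirtinger (fun w => f w + g w) (fun i => p i + p' i) (fun i => q i + q' i) z := by
  have key := fderiv_fun_add hf.1 hg.1
  refine ⟨hf.1.fun_add hg.1, fun i => ?_, fun i => ?_⟩
  · rw [← hf.2, ← hg.2]; simp only [dz, key, add_apply]; ring
  · rw [← hf.3, ← hg.3]; simp only [dzbar, key, add_apply]; ring

theorem mul (hf : HasWirtinger f p q z) (hg : HasWirtinger g p' q' z) :
    HasWirtinger (fun w => f w * g w) (fun i => f z * p' i + p i * g z)
      (fun i => f z * q' i + q i * g z) z := by
  have key := fderiv_fun_mul hf.1 hg.1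
  refine ⟨hf.1.fun_mul hg.1, fun i => ?_, fun i => ?_⟩
  · rw [← hf.2, ← hg.2]
    simp only [dz, key, add_apply, smul_apply, smul_eq_mul]
    ring
  · rw [← hf.3, ← hg.3]
    simp only [dzbar, key, add_apply, smul_apply,
      smul_eq_mul]
    ring

theorem coord (j : Fin n) :
    HasWirtinger (fun w : Fin n → ℂ => w j) (fun i => (1 : Matrix (Fin n) (Fin n) ℂ) i j)
      (fun _ => 0) z := by
  have key : HasFDerivAt (fun w : Fin n → ℂ => w j)
      (ContinuousLinearMap.proj (R := ℝ) (φ := fun _ : Fin n => ℂ) j) z := hasFDerivAt_apply j z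
  refine ⟨key.differentiableAt, fun i => ?_, fun i => ?_⟩
  · simp only [dz, key.fderiv, ContinuousLinearMap.proj_apply]
    by_cases h : i = j
    · subst h; simp; norm_num
    · simp [Matrix.one_apply_ne h, Pi.single_eq_of_ne (Ne.symm h)]
  · simp only [dzbar, key.fderiv, ContinuousLinearMap.proj_apply]
    by_cases h : i = j
    · subst h; simp
    · simp [Pi.single_eq_of_ne (Ne.symm h)]

theorem star (hf : HasWirtinger f p q z) :
    HasWirtinger (fun w => conj (f w)) (fun i => conj (q i)) (fun i => conj (p i)) z := by
  have key : HasFDerivAt (fun w => conj (f w))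
      ((Complex.conjCLE : ℂ →L[ℝ] ℂ).comp (fderiv ℝ f z)) z :=
    (Complex.conjCLE : ℂ →L[ℝ] ℂ).hasFDerivAt.comp z hf.1.hasFDerivAt
  refine ⟨key.differentiableAt, fun i => ?_, fun i => ?_⟩
  · rw [← hf.3]; simp only [dz, dzbar, key.fderiv]; simp [sub_eq_add_neg, map_ofNat]
  · rw [← hf.2]; simp only [dz, dzbar, key.fderiv]; simp [sub_eq_add_neg, map_ofNat]

/-- Chain rule for a real function of a real-valued function. -/
theorem real_comp {h : ℝ → ℝ} {h' : ℝ} {u : (Fin n → ℂ) → ℝ}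
    (hh : HasDerivAt h h' (u z)) (hu : HasWirtinger (fun w => (u w : ℂ)) p q z) :
    HasWirtinger (fun w => (h (u w) : ℂ)) (fun i => h' * p i) (fun i => h' * q i) z := by
  have hu1 : DifferentiableAt ℝ u z := by
    have := Complex.reCLM.differentiableAt.comp z hu.1
    exact this
  have k0 : HasFDerivAt (fun w => (u w : ℂ)) (Complex.ofRealCLM.comp (fderiv ℝ u z)) z :=
    Complex.ofRealCLM.hasFDerivAt.comp z hu1.hasFDerivAt
  have k1 : HasFDerivAt (fun w => (h (u w) : ℂ))
      (Complex.ofRealCLM.comp (h' • fderiv ℝ u z)) z :=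
    Complex.ofRealCLM.hasFDerivAt.comp z (hh.comp_hasFDerivAt z hu1.hasFDerivAt)
  refine ⟨k1.differentiableAt, fun i => ?_, fun i => ?_⟩
  · rw [← hu.2]; simp only [dz, k0.fderiv, k1.fderiv]; simp; ring
  · rw [← hu.3]; simp only [dzbar, k0.fderiv, k1.fderiv]; simp; ring

theorem sum {ι : Type*} (s : Finset ι) {f : ι → (Fin n → ℂ) → ℂ} {p q : ι → Fin n → ℂ}
    (hf : ∀ a ∈ s, HasWirtinger (f a) (p a) (q a) z) :
    HasWirtinger (fun w => ∑ a ∈ s, f a w) (fun i => ∑ a ∈ s, p a i)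
      (fun i => ∑ a ∈ s, q a i) z := by
  classical
  induction s using Finset.induction_on with
  | empty => simpa using const (z := z) (n := n) 0
  | insert a s ha ih =>
    simp only [Finset.sum_insert ha]
    exact (hf a (by simp)).add (ih fun b hb => hf b (by simp [hb]))

theorem nsq : HasWirtinger (fun w : Fin n → ℂ => (nsq w : ℂ)) (fun i => conj (z i)) z z := by
  have h := sum (z := z) Finset.univ fun (a : Fin n) _ => ((coord (z := z) a).star).mul (coord a)
  have e : (fun w : Fin n → ℂ => (TYZ.nsq w : ℂ)) = fun w => ∑ a, conj (w a) * w a := by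
    funext w
    simp only [TYZ.nsq, Complex.ofReal_sum]
    exact Finset.sum_congr rfl fun a _ => by rw [Complex.conj_mul']; push_cast; rfl
  rw [e]
  refine h.congr ?_ ?_
  · funext i; simp [Matrix.one_apply]
  · funext i; simp [Matrix.one_apply, apply_ite]

theorem radial {h : ℝ → ℝ} {h' : ℝ} (hh : HasDerivAt h h' (TYZ.nsq z)) :
    HasWirtinger (fun w => (h (TYZ.nsq w) : ℂ)) (fun i => h' * conj (z i)) (fun i => h' * z i) z :=
  real_comp hh nsq

end HasWirtinger

end Wirtinger

/-! ### Contractions of four-index tensors -/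

section Contraction

variable {ι : Type*} [Fintype ι] {R : Type*} [CommRing R]

/-- The tensor `M_{ij} N_{kl}`. -/
def tensorE (M N : Matrix ι ι R) (i j k l : ι) : R := M i j * N k l

/-- The tensor `M_{il} N_{kj}`. -/
def tensorS (M N : Matrix ι ι R) (i j k l : ι) : R := M i l * N k j

/-- Second and fourth index raised by `H`. -/
def mix (H : Matrix ι ι R) (X : ι → ι → ι → ι → R) (i b k d : ι) : R :=
  ∑ j, ∑ l, X i j k l * H j b * H l d

/-- The contraction `∑_{k,p,e} X_{b k p e} Y_{k i e p}` of two mixed tensors. -/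
def pair (X Y : ι → ι → ι → ι → R) : Matrix ι ι R :=
  Matrix.of fun b i => ∑ k, ∑ p, ∑ e, X b k p e * Y k i e p

omit [Fintype ι] in
theorem tensorE_smul_left (c : R) (M N : Matrix ι ι R) :
    tensorE (c • M) N = c • tensorE M N := by
  funext i j k l; simp [tensorE, mul_assoc]

omit [Fintype ι] in
theorem tensorE_smul_right (c : R) (M N : Matrix ι ι R) :
    tensorE M (c • N) = c • tensorE M N := by
  funext i j k l; simp [tensorE, mul_left_comm]

omit [Fintype ι] in
theorem tensorE_add_left (M M' N : Matrix ι ι R) :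
    tensorE (M + M') N = tensorE M N + tensorE M' N := by
  funext i j k l; simp [tensorE, add_mul]

omit [Fintype ι] in
theorem tensorE_add_right (M N N' : Matrix ι ι R) :
    tensorE M (N + N') = tensorE M N + tensorE M N' := by
  funext i j k l; simp [tensorE, mul_add]

omit [Fintype ι] in
theorem tensorS_smul_left (c : R) (M N : Matrix ι ι R) :
    tensorS (c • M) N = c • tensorS M N := by
  funext i j k l; simp [tensorS, mul_assoc]

omit [Fintype ι] in
theorem tensorS_smul_right (c : R) (M N : Matrix ι ι R) :
    tensorS M (c • N) = c • tensorS M N := by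
  funext i j k l; simp [tensorS, mul_left_comm]

theorem mix_add (H : Matrix ι ι R) (X Y : ι → ι → ι → ι → R) :
    mix H (X + Y) = mix H X + mix H Y := by
  funext i b k d; simp [mix, add_mul, Finset.sum_add_distrib]

theorem mix_smul (H : Matrix ι ι R) (c : R) (X : ι → ι → ι → ι → R) :
    mix H (c • X) = c • mix H X := by
  funext i b k d; simp [mix, mul_assoc, Finset.mul_sum]

theorem mix_tensorE (H M N : Matrix ι ι R) :
    mix H (tensorE M N) = tensorE (M * H) (N * H) := by
  funext i b k d
  simp only [mix, tensorE, Matrix.mul_apply, Finset.sum_mul_sum]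
  exact Finset.sum_congr rfl fun _ _ => Finset.sum_congr rfl fun _ _ => by ring

theorem mix_tensorS (H M N : Matrix ι ι R) :
    mix H (tensorS M N) = tensorS (M * H) (N * H) := by
  funext i b k d
  simp only [mix, tensorS, Matrix.mul_apply, Finset.sum_mul_sum]
  rw [Finset.sum_comm]
  exact Finset.sum_congr rfl fun _ _ => Finset.sum_congr rfl fun _ _ => by ring

theorem pair_add_left (X X' Y : ι → ι → ι → ι → R) :
    pair (X + X') Y = pair X Y + pair X' Y := by
  ext b i; simp [pair, add_mul, Finset.sum_add_distrib]

theorem pair_add_right (X Y Y' : ι → ι → ι → ι → R) :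
    pair X (Y + Y') = pair X Y + pair X Y' := by
  ext b i; simp [pair, mul_add, Finset.sum_add_distrib]

theorem pair_smul_left (c : R) (X Y : ι → ι → ι → ι → R) :
    pair (c • X) Y = c • pair X Y := by
  ext b i; simp [pair, mul_assoc, Finset.mul_sum]

theorem pair_smul_right (c : R) (X Y : ι → ι → ι → ι → R) :
    pair X (c • Y) = c • pair X Y := by
  ext b i; simp [pair, mul_left_comm, Finset.mul_sum]

theorem pair_tensorE_tensorE (M N M' N' : Matrix ι ι R) :
    pair (tensorE M N) (tensorE M' N') = (N * N').trace • (M * M') := by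
  ext b i
  simp only [pair, tensorE, Matrix.of_apply, Matrix.smul_apply, Matrix.trace, Matrix.diag,
    Matrix.mul_apply, smul_eq_mul, Finset.sum_mul, Finset.mul_sum]
  exact Finset.sum_congr rfl fun _ _ => Finset.sum_congr rfl fun _ _ =>
    Finset.sum_congr rfl fun _ _ => by ring

theorem pair_tensorS_tensorE (M N M' N' : Matrix ι ι R) :
    pair (tensorS M N) (tensorE M' N') = M * N' * N * M' := by
  ext b i
  simp only [pair, tensorE, tensorS, Matrix.of_apply, Matrix.mul_apply, Finset.sum_mul]
  exact Finset.sum_congr rfl fun _ _ => Finset.sum_congr rfl fun _ _ =>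
    Finset.sum_congr rfl fun _ _ => by ring

theorem pair_tensorE_tensorS (M N M' N' : Matrix ι ι R) :
    pair (tensorE M N) (tensorS M' N') = M * M' * N * N' := by
  ext b i
  simp only [pair, tensorE, tensorS, Matrix.of_apply, Matrix.mul_apply, Finset.sum_mul]
  rw [Finset.sum_comm_cycle]
  refine Finset.sum_congr rfl fun _ _ => ?_
  rw [Finset.sum_comm]
  exact Finset.sum_congr rfl fun _ _ =>
    Finset.sum_congr rfl fun _ _ => by ring

theorem pair_tensorS_tensorS (M N M' N' : Matrix ι ι R) :
    pair (tensorS M N) (tensorS M' N') = (N * M').trace • (M * N') := by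
  ext b i
  simp only [pair, tensorS, Matrix.of_apply, Matrix.smul_apply, Matrix.trace, Matrix.diag,
    Matrix.mul_apply, smul_eq_mul, Finset.sum_mul, Finset.mul_sum]
  rw [Finset.sum_comm_cycle]
  refine Finset.sum_congr rfl fun _ _ => ?_
  rw [Finset.sum_comm]
  exact Finset.sum_congr rfl fun _ _ =>
    Finset.sum_congr rfl fun _ _ => by ring

/-- Full contraction of two four-index tensors: it is computed on the mixed tensors. -/
theorem sum_eight_eq_trace_pair (H : Matrix ι ι R) (X Y : ι → ι → ι → ι → R) :
    ∑ i, ∑ j, ∑ k, ∑ l, ∑ a, ∑ b, ∑ c, ∑ d,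
      H a i * H j b * H c k * H l d * X i j k l * Y b a d c =
      (pair (mix H X) (mix H Y)).trace := by
  calc _ = ∑ t : ι × ι × ι × ι × ι × ι × ι × ι,
        H t.2.2.2.2.1 t.1 * H t.2.1 t.2.2.2.2.2.1 * H t.2.2.2.2.2.2.1 t.2.2.1 *
        H t.2.2.2.1 t.2.2.2.2.2.2.2 * X t.1 t.2.1 t.2.2.1 t.2.2.2.1 *
        Y t.2.2.2.2.2.1 t.2.2.2.2.1 t.2.2.2.2.2.2.2 t.2.2.2.2.2.2.1 := by
        simp only [Fintype.sum_prod_type]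
    _ = ∑ t : ι × ι × ι × ι × ι × ι × ι × ι,
        X t.1 t.2.2.2.2.1 t.2.2.1 t.2.2.2.2.2.2.1 * H t.2.2.2.2.1 t.2.1 *
          H t.2.2.2.2.2.2.1 t.2.2.2.1 *
        (Y t.2.1 t.2.2.2.2.2.1 t.2.2.2.1 t.2.2.2.2.2.2.2 * H t.2.2.2.2.2.1 t.1 *
          H t.2.2.2.2.2.2.2 t.2.2.1) :=
        Fintype.sum_equiv
          ⟨fun ⟨i, j, k, l, a, b, c, d⟩ => (i, b, k, d, j, a, l, c),
           fun ⟨i, b, k, d, j, a, l, c⟩ => (i, j, k, l, a, b, c, d),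
           fun _ => rfl, fun _ => rfl⟩ _ _ fun _ => by simp only [Equiv.coe_fn_mk]; ring
    _ = _ := by
        simp only [Fintype.sum_prod_type, pair, mix, Matrix.trace, Matrix.diag, Matrix.of_apply,
          Finset.sum_mul_sum]

/-- Contraction of a two-index tensor with two copies of a four-index tensor. -/
theorem sum_ten_eq_trace (H T : Matrix ι ι R) (X : ι → ι → ι → ι → R) :
    ∑ i, ∑ j, ∑ k, ∑ p, ∑ q, ∑ a, ∑ b, ∑ c, ∑ d, ∑ e,
      H a i * H j b * H c k * H d p * H q e * T i j * X b c p q * X k a e d =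
      (T * H * pair (mix H X) (mix H X)).trace := by
  calc _ = ∑ t : ι × ι × ι × ι × ι × ι × ι × ι × ι × ι,
        H t.2.2.2.2.2.1 t.1 * H t.2.1 t.2.2.2.2.2.2.1 * H t.2.2.2.2.2.2.2.1 t.2.2.1 *
        H t.2.2.2.2.2.2.2.2.1 t.2.2.2.1 * H t.2.2.2.2.1 t.2.2.2.2.2.2.2.2.2 * T t.1 t.2.1 *
        X t.2.2.2.2.2.2.1 t.2.2.2.2.2.2.2.1 t.2.2.2.1 t.2.2.2.2.1 *
        X t.2.2.1 t.2.2.2.2.2.1 t.2.2.2.2.2.2.2.2.2 t.2.2.2.2.2.2.2.2.1 := by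
        simp only [Fintype.sum_prod_type]
    _ = ∑ t : ι × ι × ι × ι × ι × ι × ι × ι × ι × ι,
        T t.1 t.2.2.1 * H t.2.2.1 t.2.1 *
        (X t.2.1 t.2.2.2.2.2.2.1 t.2.2.2.2.1 t.2.2.2.2.2.2.2.2.1 *
          H t.2.2.2.2.2.2.1 t.2.2.2.1 * H t.2.2.2.2.2.2.2.2.1 t.2.2.2.2.2.1 *
        (X t.2.2.2.1 t.2.2.2.2.2.2.2.1 t.2.2.2.2.2.1 t.2.2.2.2.2.2.2.2.2 *
          H t.2.2.2.2.2.2.2.1 t.1 * H t.2.2.2.2.2.2.2.2.2 t.2.2.2.2.1)) :=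
        Fintype.sum_equiv
          ⟨fun ⟨i, j, k, p, q, a, b, c, d, e⟩ => (i, b, j, k, p, e, c, a, q, d),
           fun ⟨i, b, j, k, p, e, c, a, q, d⟩ => (i, j, k, p, q, a, b, c, d, e),
           fun _ => rfl, fun _ => rfl⟩ _ _ fun _ => by simp only [Equiv.coe_fn_mk]; ring
    _ = _ := by
        simp only [Fintype.sum_prod_type, pair, mix, Matrix.trace, Matrix.diag, Matrix.of_apply,
          Matrix.mul_apply, Finset.sum_mul_sum]
        simp only [Finset.mul_sum]

theorem sum_four_eq_trace (H T : Matrix ι ι R) :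
    ∑ i, ∑ j, ∑ a, ∑ b, H a i * H j b * T i j * T b a = (T * H * (T * H)).trace := by
  calc _ = ∑ t : ι × ι × ι × ι, H t.2.2.1 t.1 * H t.2.1 t.2.2.2 * T t.1 t.2.1 *
        T t.2.2.2 t.2.2.1 := by simp only [Fintype.sum_prod_type]
    _ = ∑ t : ι × ι × ι × ι, T t.1 t.2.2.1 * H t.2.2.1 t.2.1 * (T t.2.1 t.2.2.2 * H t.2.2.2 t.1) :=
        Fintype.sum_equiv ⟨fun ⟨i, j, a, b⟩ => (i, b, j, a), fun ⟨i, b, j, a⟩ => (i, j, a, b),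
           fun _ => rfl, fun _ => rfl⟩ _ _ fun _ => by simp only [Equiv.coe_fn_mk]; ring
    _ = _ := by
        simp only [Fintype.sum_prod_type, Matrix.trace, Matrix.diag,
          Matrix.mul_apply, Finset.sum_mul_sum]

/-- The three-index tensor `u_k M_{ij} + u_i M_{kj}`. -/
def tensorF (u : ι → R) (M : Matrix ι ι R) (i j k : ι) : R := u k * M i j + u i * M k j

/-- Full contraction of two tensors of the type `tensorF`, the second one with its indices
transposed. -/
theorem sum_six_tensorF (H M N : Matrix ι ι R) (u v : ι → R) :
    ∑ i, ∑ j, ∑ k, ∑ a, ∑ b, ∑ c, H a i * H j b * H c k * tensorF u M i j k *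
      (v c * N b a + v a * N b c) =
      2 * ((Matrix.vecMul v H ⬝ᵥ u) * (M * H * (N * H)).trace +
        Matrix.vecMul v H ⬝ᵥ (Matrix.mulVec (M * H * (N * H)) u)) := by
  set S := M * H with hS
  set T := N * H with hT
  set w := Matrix.vecMul v H with hw
  have e1 : ∑ i, ∑ j, ∑ k, ∑ a, ∑ b, ∑ c, H a i * H j b * H c k * tensorF u M i j k *
      (v c * N b a + v a * N b c) =
      ∑ i, ∑ b, ∑ k, (u k * S i b + u i * S k b) * (w k * T b i + w i * T b k) := by
    calc _ = ∑ t : ι × ι × ι × ι × ι × ι,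
          H t.2.2.2.1 t.1 * H t.2.1 t.2.2.2.2.1 * H t.2.2.2.2.2 t.2.2.1 *
            tensorF u M t.1 t.2.1 t.2.2.1 *
            (v t.2.2.2.2.2 * N t.2.2.2.2.1 t.2.2.2.1 +
              v t.2.2.2.1 * N t.2.2.2.2.1 t.2.2.2.2.2) := by simp only [Fintype.sum_prod_type]
      _ = ∑ t : ι × ι × ι × ι × ι × ι,
          (u t.2.2.1 * (M t.1 t.2.2.2.1 * H t.2.2.2.1 t.2.1) +
            u t.1 * (M t.2.2.1 t.2.2.2.1 * H t.2.2.2.1 t.2.1)) *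
          ((v t.2.2.2.2.1 * H t.2.2.2.2.1 t.2.2.1) *
              (N t.2.1 t.2.2.2.2.2 * H t.2.2.2.2.2 t.1) +
            (v t.2.2.2.2.2 * H t.2.2.2.2.2 t.1) * (N t.2.1 t.2.2.2.2.1 *
              H t.2.2.2.2.1 t.2.2.1)) :=
          Fintype.sum_equiv
            ⟨fun ⟨i, j, k, a, b, c⟩ => (i, b, k, j, c, a),
             fun ⟨i, b, k, j, c, a⟩ => (i, j, k, a, b, c),
             fun _ => rfl, fun _ => rfl⟩ _ _ fun _ => by
              simp only [Equiv.coe_fn_mk, tensorF]; ring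
      _ = _ := by
          simp only [Fintype.sum_prod_type]
          refine Finset.sum_congr rfl fun i _ => Finset.sum_congr rfl fun b _ =>
            Finset.sum_congr rfl fun k _ => ?_
          simp only [← Finset.mul_sum, ← Finset.sum_mul, Finset.sum_add_distrib]
          rfl
  have e2 : ∑ i, ∑ b, ∑ k, (u i * S k b) * (w i * T b k) =
      ∑ i, ∑ b, ∑ k, (u k * S i b) * (w k * T b i) := by
    rw [Finset.sum_comm_cycle]
    exact Finset.sum_congr rfl fun _ _ => Finset.sum_comm
  have e3 : ∑ i, ∑ b, ∑ k, (u i * S k b) * (w k * T b i) =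
      ∑ i, ∑ b, ∑ k, (u k * S i b) * (w i * T b k) := by
    rw [Finset.sum_comm_cycle]
    exact Finset.sum_congr rfl fun _ _ => Finset.sum_comm
  have e4 : ∑ i, ∑ b, ∑ k, (u k * S i b) * (w k * T b i) = (w ⬝ᵥ u) * (S * T).trace := by
    simp only [dotProduct, Matrix.trace, Matrix.diag, Matrix.mul_apply, Finset.mul_sum,
      Finset.sum_mul]
    exact Finset.sum_congr rfl fun _ _ => Finset.sum_congr rfl fun _ _ =>
      Finset.sum_congr rfl fun _ _ => by ring
  have e5 : ∑ i, ∑ b, ∑ k, (u k * S i b) * (w i * T b k) =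
      w ⬝ᵥ (Matrix.mulVec (S * T) u) := by
    simp only [dotProduct, Matrix.mulVec, Matrix.mul_apply, Finset.mul_sum,
      Finset.sum_mul]
    refine Finset.sum_congr rfl fun _ _ => ?_
    rw [Finset.sum_comm]
    exact Finset.sum_congr rfl fun _ _ =>
      Finset.sum_congr rfl fun _ _ => by ring
  rw [e1]
  simp only [add_mul, mul_add, Finset.sum_add_distrib]
  rw [e2, e3, e4, e5]
  ring

end Contraction

/-! ### Tensors built from a pair of complementary projections -/

section Projections

variable {ι : Type*} [Fintype ι] {R : Type*} [CommRing R]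

/-- Two orthogonal idempotents, `P` of trace `1` and `Q` of trace `m`. -/
structure IsProjPair (P Q : Matrix ι ι R) (m : R) : Prop where
  PP : P * P = P
  QQ : Q * Q = Q
  PQ : P * Q = 0
  QP : Q * P = 0
  traceP : P.trace = 1
  traceQ : Q.trace = m

/-- The four-index tensors `T_{i j̄ k l̄}`, symmetric in `i` and `k`, that are built from the
projections `P` and `Q`. -/
def tensorK (P Q : Matrix ι ι R) (A B₁ B₂ C : R) : ι → ι → ι → ι → R :=
  A • tensorE P P + B₁ • (tensorE Q P + tensorS P Q) + B₂ • (tensorE P Q + tensorS Q P) +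
    C • (tensorE Q Q + tensorS Q Q)

namespace IsProjPair

variable {P Q : Matrix ι ι R} {m : R} (h : IsProjPair P Q m)
include h

theorem mul_lincomb (a b c d : R) :
    (a • P + b • Q) * (c • P + d • Q) = (a * c) • P + (b * d) • Q := by
  simp only [add_mul, mul_add, Matrix.smul_mul, Matrix.mul_smul, h.PP, h.QQ, h.PQ, h.QP,
    smul_smul, smul_zero, add_zero, zero_add,
    mul_comm]

theorem trace_lincomb (a b : R) : (a • P + b • Q).trace = a + b * m := by
  simp [h.traceP, h.traceQ]

theorem mix_tensorK (a b A B₁ B₂ C : R) :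
    mix (a • P + b • Q) (tensorK P Q A B₁ B₂ C) =
      tensorK P Q (A * a * a) (B₁ * a * b) (B₂ * a * b) (C * b * b) := by
  have hP : P * (a • P + b • Q) = a • P := by simp [mul_add, h.PP, h.PQ]
  have hQ : Q * (a • P + b • Q) = b • Q := by simp [mul_add, h.QP, h.QQ]
  simp only [tensorK, mix_add, mix_smul, mix_tensorE, mix_tensorS, hP, hQ, tensorE_smul_left,
    tensorE_smul_right, tensorS_smul_left, tensorS_smul_right]
  module

theorem pair_tensorK (A B₁ B₂ C A' B₁' B₂' C' : R) :
    pair (tensorK P Q A B₁ B₂ C) (tensorK P Q A' B₁' B₂' C') =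
      (A * A' + m * (B₁ + B₂) * B₂') • P + ((B₁ + B₂) * B₁' + 2 * (m + 1) * C * C') • Q := by
  simp only [tensorK, pair_add_left, pair_add_right, pair_smul_left, pair_smul_right,
    pair_tensorE_tensorE, pair_tensorE_tensorS, pair_tensorS_tensorE, pair_tensorS_tensorS,
    h.PP, h.QQ, h.PQ, h.QP, h.traceP, h.traceQ, Matrix.trace_zero, zero_smul, smul_zero,
    Matrix.zero_mul, add_zero, zero_add, one_smul]
  module

theorem trace_pair_tensorK (A B₁ B₂ C A' B' C' : R) :
    (pair (tensorK P Q A B₁ B₂ C) (tensorK P Q A' B' B' C')).trace =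
      A * A' + 2 * m * (B₁ + B₂) * B' + 2 * m * (m + 1) * C * C' := by
  rw [h.pair_tensorK, h.trace_lincomb]; ring

theorem trace_pair_tensorK_tensorE (A B C a b : R) :
    (pair (tensorK P Q A B B C) (tensorE (a • P + b • Q) (a • P + b • Q))).trace =
      A * a ^ 2 + 2 * m * B * a * b + m * (m + 1) * C * b ^ 2 := by
  simp only [tensorK, pair_add_left, pair_add_right, pair_smul_left, pair_smul_right,
    pair_tensorE_tensorE, pair_tensorS_tensorE, tensorE_add_left, tensorE_add_right,
    tensorE_smul_left, tensorE_smul_right,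
    h.PP, h.QQ, h.PQ, h.QP, h.traceP, h.traceQ, Matrix.trace_zero, zero_smul, smul_zero,
    Matrix.zero_mul, add_zero, zero_add, one_smul, Matrix.trace_add,
    Matrix.trace_smul, smul_eq_mul]
  ring

end IsProjPair

end Projections

/-! ### The momentum profile of a radial metric of constant scalar curvature -/

/-- The data describing a radial metric of constant scalar curvature `(m + 1)(m + 2) κ`: the
momentum coordinate `y`, as a function of `x = |z|²`, and the two quantities `X` and `Y` that
measure the deviation from constant holomorphic sectional curvature. They are the multiples of
`y ^ (-(m + 1))` and of `y ^ (-(m + 2))` whose sum is `(x y' - y) / y² + κ`. -/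
structure Profile where
  /-- One `(m + 1)(m + 2)`-th of the scalar curvature. -/
  κ : ℝ
  /-- The complex dimension minus one. -/
  m : ℝ
  /-- The momentum coordinate. -/
  y : ℝ → ℝ
  /-- `κ (m + 2)` minus the Ricci eigenvalue orthogonal to the radial direction. -/
  X : ℝ → ℝ
  /-- `(x y' - y) / y² + κ` minus `X`. -/
  Y : ℝ → ℝ

namespace Profile

variable (S : Profile) {t : ℝ}

/-- `(x y' - y) / y²`. -/
def s (t : ℝ) : ℝ := S.X t + S.Y t - S.κ

/-- The logarithmic derivative `x y' / y`. -/
def w (t : ℝ) : ℝ := 1 + S.y t * S.s t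

/-- `-x s' / w`. -/
def τ (t : ℝ) : ℝ := (S.m + 1) * S.X t + (S.m + 2) * S.Y t

/-- `-x τ' / w`. -/
def τ₂ (t : ℝ) : ℝ := (S.m + 1) ^ 2 * S.X t + (S.m + 2) ^ 2 * S.Y t

/-- The Ricci eigenvalue in the radial direction. -/
def rP (t : ℝ) : ℝ := (S.m + 2) * S.κ + S.m * S.X t

/-- The Ricci eigenvalue orthogonal to the radial direction. -/
def rQ (t : ℝ) : ℝ := (S.m + 2) * S.κ - S.X t

/-- The differential equations satisfied by a profile, at the point `t`, together with
positivity of the metric. -/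
structure SolvesAt (t : ℝ) : Prop where
  pos : 0 < t
  y_pos : 0 < S.y t
  w_pos : 0 < S.w t
  hy : HasDerivAt S.y (S.y t * S.w t / t) t
  hX : HasDerivAt S.X (-((S.m + 1) * S.X t * S.w t / t)) t
  hY : HasDerivAt S.Y (-((S.m + 2) * S.Y t * S.w t / t)) t

/-- The metric is `a δ_{ij} + b z̄_i z_j`. -/
def a (t : ℝ) : ℝ := S.y t / t

/-- The derivative of `a`. -/
def b (t : ℝ) : ℝ := S.y t ^ 2 * S.s t / t ^ 2

/-- The derivative of `b`. -/
def b₁ (t : ℝ) : ℝ := S.y t ^ 2 * (2 * S.w t * S.s t - S.w t * S.τ t - 2 * S.s t) / t ^ 3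

/-- The derivative of `b₁`. -/
def b₂ (t : ℝ) : ℝ :=
  S.y t ^ 2 * ((2 * S.w t - 3) * (2 * S.w t * S.s t - S.w t * S.τ t - 2 * S.s t) +
    2 * S.y t * S.w t * (S.s t - S.τ t) * S.s t - 2 * S.w t ^ 2 * S.τ t
    - S.y t * S.w t * (S.s t - S.τ t) * S.τ t + S.w t ^ 2 * S.τ₂ t + 2 * S.w t * S.τ t) / t ^ 4

/-- The Ricci tensor is `c δ_{ij} + e z̄_i z_j`. -/
def c (t : ℝ) : ℝ := S.y t * S.rQ t / t

/-- The coefficient of `z̄_i z_j` in the Ricci tensor. -/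
def e (t : ℝ) : ℝ := S.y t * (S.w t * S.rP t - S.rQ t) / t ^ 2

/-- The derivative of `c`. -/
def c₁ (t : ℝ) : ℝ :=
  S.y t * (S.w t * S.rQ t + (S.m + 1) * S.w t * S.X t - S.rQ t) / t ^ 2

/-- The derivative of `e`. -/
def e₁ (t : ℝ) : ℝ :=
  S.y t * ((S.w t - 2) * (S.w t * S.rP t - S.rQ t) + S.y t * S.w t * (S.s t - S.τ t) * S.rP t
    - S.m * (S.m + 1) * S.X t * S.w t ^ 2 - (S.m + 1) * S.X t * S.w t) / t ^ 3

/-- The covariant derivative of the Ricci tensor is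
`l (z̄_k δ_{ij} + z̄_i δ_{kj}) + u z̄_i z̄_k z_j`. -/
def l (t : ℝ) : ℝ := (S.m + 1) * S.y t * S.w t * S.X t / t ^ 2

/-- The coefficient of `z̄_i z̄_k z_j` in the covariant derivative of the Ricci tensor. -/
def u (t : ℝ) : ℝ := -((S.m + 1) * S.y t * S.w t * S.X t * (S.m * S.w t + 2) / t ^ 3)

/-- The derivative of `l`. -/
def l₁ (t : ℝ) : ℝ :=
  (S.m + 1) * S.y t * S.w t * S.X t *
    (S.w t + S.y t * (S.s t - S.τ t) - (S.m + 1) * S.w t - 2) / t ^ 3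

/-- The derivative of `u`. -/
def u₁ (t : ℝ) : ℝ :=
  -((S.m + 1) * S.y t * S.w t * S.X t *
    ((S.w t + S.y t * (S.s t - S.τ t) - (S.m + 1) * S.w t - 3) * (S.m * S.w t + 2) +
      S.m * S.y t * S.w t * (S.s t - S.τ t)) / t ^ 4)

namespace SolvesAt

variable {S} (h : S.SolvesAt t)
include h

theorem hasDerivAt_s : HasDerivAt S.s (-(S.w t * S.τ t / t)) t := by
  refine ((h.hX.add h.hY).sub_const S.κ).congr_deriv ?_
  simp only [τ]; ring

theorem hasDerivAt_w : HasDerivAt S.w (S.y t * S.w t * (S.s t - S.τ t) / t) t := by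
  refine ((h.hy.mul h.hasDerivAt_s).const_add 1).congr_deriv ?_
  ring

theorem hasDerivAt_τ : HasDerivAt S.τ (-(S.w t * S.τ₂ t / t)) t := by
  refine ((h.hX.const_mul (S.m + 1)).add (h.hY.const_mul (S.m + 2))).congr_deriv ?_
  simp only [τ₂]; ring

theorem hasDerivAt_rP : HasDerivAt S.rP (-(S.m * (S.m + 1) * S.X t * S.w t / t)) t := by
  refine ((h.hX.const_mul S.m).const_add ((S.m + 2) * S.κ)).congr_deriv ?_
  ring

theorem hasDerivAt_rQ : HasDerivAt S.rQ ((S.m + 1) * S.X t * S.w t / t) t := by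
  refine (h.hX.const_sub ((S.m + 2) * S.κ)).congr_deriv ?_
  ring

theorem hasDerivAt_div_pow {f : ℝ → ℝ} {f' : ℝ} (hf : HasDerivAt f f' t) (k : ℕ) :
    HasDerivAt (fun r => f r / r ^ (k + 1)) ((t * f' - (k + 1) * f t) / t ^ (k + 2)) t := by
  have ht := h.pos.ne'
  refine (hf.div (hasDerivAt_pow (k + 1) t) (pow_ne_zero _ ht)).congr_deriv ?_
  have : k + 1 - 1 = k := rfl
  rw [this]
  push_cast
  field_simp
  ring

theorem hasDerivAt_a : HasDerivAt S.a (S.b t) t := by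
  have ht := h.pos.ne'
  have := h.hasDerivAt_div_pow h.hy 0
  simp only [zero_add, pow_one] at this
  refine this.congr_deriv ?_
  simp only [b, w]; field_simp; push_cast; ring

theorem hasDerivAt_b : HasDerivAt S.b (S.b₁ t) t := by
  have ht := h.pos.ne'
  refine (h.hasDerivAt_div_pow ((h.hy.pow 2).mul h.hasDerivAt_s) 1).congr_deriv ?_
  simp only [b₁, Pi.pow_apply, Pi.mul_apply]; field_simp; push_cast; ring

theorem hasDerivAt_b₁ : HasDerivAt S.b₁ (S.b₂ t) t := by
  have ht := h.pos.ne'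
  refine (h.hasDerivAt_div_pow ((h.hy.pow 2).mul
    ((((h.hasDerivAt_w.const_mul 2).mul h.hasDerivAt_s).sub
      (h.hasDerivAt_w.mul h.hasDerivAt_τ)).sub (h.hasDerivAt_s.const_mul 2))) 2).congr_deriv ?_
  simp only [b₂, Pi.pow_apply, Pi.mul_apply, Pi.sub_apply]; field_simp; push_cast; ring

theorem hasDerivAt_c : HasDerivAt S.c (S.c₁ t) t := by
  have ht := h.pos.ne'
  have := h.hasDerivAt_div_pow (h.hy.mul h.hasDerivAt_rQ) 0
  simp only [zero_add, pow_one] at this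
  refine this.congr_deriv ?_
  simp only [c₁, Pi.mul_apply]; field_simp; push_cast; ring

theorem hasDerivAt_e : HasDerivAt S.e (S.e₁ t) t := by
  have ht := h.pos.ne'
  refine (h.hasDerivAt_div_pow (h.hy.mul ((h.hasDerivAt_w.mul h.hasDerivAt_rP).sub
    h.hasDerivAt_rQ)) 1).congr_deriv ?_
  simp only [e₁, Pi.mul_apply, Pi.sub_apply]; field_simp; push_cast; ring

theorem hasDerivAt_l : HasDerivAt S.l (S.l₁ t) t := by
  have ht := h.pos.ne'
  refine (h.hasDerivAt_div_pow (((h.hy.const_mul (S.m + 1)).mul h.hasDerivAt_w).mul h.hX)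
    1).congr_deriv ?_
  simp only [l₁, Pi.mul_apply]; field_simp; push_cast; ring

theorem hasDerivAt_u : HasDerivAt S.u (S.u₁ t) t := by
  have ht := h.pos.ne'
  refine (h.hasDerivAt_div_pow ((((h.hy.const_mul (S.m + 1)).mul h.hasDerivAt_w).mul h.hX).mul
    ((h.hasDerivAt_w.const_mul S.m).add_const 2)) 2).neg.congr_deriv ?_
  simp only [u₁, Pi.mul_apply]; field_simp; push_cast; ring

end SolvesAt
end Profile

/-! ### Tensors of a radial metric in coordinates -/

section Forms

variable {n : ℕ}

/-- The tensor `c δ_{ij} + e z̄_i z_j`. -/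
def form2 (c e : ℂ) (z : Fin n → ℂ) (i j : Fin n) : ℂ :=
  c * (1 : Matrix (Fin n) (Fin n) ℂ) i j + e * (conj (z i) * z j)

/-- The tensor `l (z̄_k δ_{ij} + z̄_i δ_{kj}) + u z̄_i z̄_k z_j`. -/
def form3 (l u : ℂ) (z : Fin n → ℂ) (i j k : Fin n) : ℂ :=
  l * (conj (z k) * (1 : Matrix (Fin n) (Fin n) ℂ) i j +
    conj (z i) * (1 : Matrix (Fin n) (Fin n) ℂ) k j) + u * (conj (z i) * conj (z k) * z j)

/-- The tensor `l (z_k δ_{ij} + z_j δ_{ik}) + u z̄_i z_j z_k`. -/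
def form3bar (l u : ℂ) (z : Fin n → ℂ) (i j k : Fin n) : ℂ :=
  l * (z k * (1 : Matrix (Fin n) (Fin n) ℂ) i j + z j * (1 : Matrix (Fin n) (Fin n) ℂ) i k) +
    u * (conj (z i) * z j * z k)

/-- The general four-index tensor built from `δ` and `z`, symmetric in the first and third
indices. -/
def form4 (α β₁ β₂ γ : ℂ) (z : Fin n → ℂ) (i j k l : Fin n) : ℂ :=
  α * ((1 : Matrix (Fin n) (Fin n) ℂ) i j * (1 : Matrix (Fin n) (Fin n) ℂ) k l +
      (1 : Matrix (Fin n) (Fin n) ℂ) i l * (1 : Matrix (Fin n) (Fin n) ℂ) k j) +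
    β₁ * ((1 : Matrix (Fin n) (Fin n) ℂ) i j * (conj (z k) * z l) +
      (conj (z i) * z l) * (1 : Matrix (Fin n) (Fin n) ℂ) k j) +
    β₂ * ((conj (z i) * z j) * (1 : Matrix (Fin n) (Fin n) ℂ) k l +
      (1 : Matrix (Fin n) (Fin n) ℂ) i l * (conj (z k) * z j)) +
    γ * (conj (z i) * z j * conj (z k) * z l)

/-- The projection onto the radial direction; as a matrix acting on columns, it fixes `z̄`. -/
def projP (z : Fin n → ℂ) : Matrix (Fin n) (Fin n) ℂ :=
  Matrix.of fun i j => conj (z i) * z j / nsq z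

/-- The projection onto the complement of the radial direction. -/
def projQ (z : Fin n → ℂ) : Matrix (Fin n) (Fin n) ℂ := 1 - projP z

theorem sum_conj_mul_self (z : Fin n → ℂ) : ∑ q, conj (z q) * z q = (nsq z : ℂ) := by
  simp only [nsq, Complex.ofReal_sum]
  exact Finset.sum_congr rfl fun a _ => by rw [Complex.conj_mul']; push_cast; rfl

theorem isProjPair {z : Fin n → ℂ} (hz : 0 < nsq z) :
    IsProjPair (projP z) (projQ z) ((n : ℂ) - 1) := by
  have hx : (nsq z : ℂ) ≠ 0 := by exact_mod_cast hz.ne'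
  have PP : projP z * projP z = projP z := by
    ext i j
    simp only [projP, Matrix.mul_apply, Matrix.of_apply]
    have : ∀ q, conj (z i) * z q / (nsq z : ℂ) * (conj (z q) * z j / nsq z) =
        (conj (z i) * z j / (nsq z * nsq z)) * (conj (z q) * z q) := fun q => by
      field_simp
    rw [Finset.sum_congr rfl fun q _ => this q, ← Finset.mul_sum, sum_conj_mul_self]
    field_simp
  have trP : (projP z).trace = 1 := by
    simp only [projP, Matrix.trace, Matrix.diag, Matrix.of_apply]
    rw [← Finset.sum_div, sum_conj_mul_self, div_self hx]
  refine ⟨PP, ?_, ?_, ?_, trP, ?_⟩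
  · simp [projQ, mul_sub, sub_mul, PP]
  · simp [projQ, mul_sub, PP]
  · simp [projQ, sub_mul, PP]
  · simp [projQ, trP]

theorem form2_eq {z : Fin n → ℂ} (hz : 0 < nsq z) (c e : ℂ) :
    Matrix.of (form2 c e z) = (c + nsq z * e) • projP z + c • projQ z := by
  have hx : (nsq z : ℂ) ≠ 0 := by exact_mod_cast hz.ne'
  ext i j
  simp only [form2, projQ, projP, Matrix.of_apply, Matrix.add_apply, Matrix.smul_apply,
    Matrix.sub_apply, smul_eq_mul]
  field_simp
  ring

theorem form3_eq {z : Fin n → ℂ} (hz : 0 < nsq z) (l u : ℂ) :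
    form3 l u z = tensorF (fun i => conj (z i)) ((l + nsq z * u / 2) • projP z + l • projQ z) := by
  have hx : (nsq z : ℂ) ≠ 0 := by exact_mod_cast hz.ne'
  funext i j k
  simp only [form3, tensorF, projQ, projP, Matrix.of_apply, Matrix.add_apply, Matrix.smul_apply,
    Matrix.sub_apply, smul_eq_mul]
  field_simp
  ring

theorem form4_eq {z : Fin n → ℂ} (hz : 0 < nsq z) (α β₁ β₂ γ : ℂ) :
    form4 α β₁ β₂ γ z = tensorK (projP z) (projQ z)
      (2 * α + 2 * nsq z * β₁ + 2 * nsq z * β₂ + nsq z ^ 2 * γ)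
      (α + nsq z * β₁) (α + nsq z * β₂) α := by
  have hx : (nsq z : ℂ) ≠ 0 := by exact_mod_cast hz.ne'
  funext i j k l
  simp only [form4, tensorK, tensorE, tensorS, projQ, projP, Matrix.of_apply, Pi.add_apply,
    Pi.smul_apply, Matrix.sub_apply, smul_eq_mul]
  field_simp
  ring

theorem sum_form2_mul (c e : ℂ) (z : Fin n → ℂ) (p : Fin n) (v : Fin n → ℂ) :
    ∑ q, form2 c e z q p * v q = c * v p + e * z p * ∑ q, conj (z q) * v q := by
  simp only [form2, add_mul, Finset.sum_add_distrib, Finset.mul_sum]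
  congr 1
  · simp [Matrix.one_apply]
  · exact Finset.sum_congr rfl fun _ _ => by ring

theorem sum_mul_form2 (c e : ℂ) (z : Fin n → ℂ) (p : Fin n) (v : Fin n → ℂ) :
    ∑ q, v q * form2 c e z p q = c * v p + e * conj (z p) * ∑ q, v q * z q := by
  simp only [form2, mul_add, Finset.sum_add_distrib, Finset.mul_sum]
  congr 1
  · simp [Matrix.one_apply, mul_comm]
  · exact Finset.sum_congr rfl fun _ _ => by ring

theorem sum_form3_mul (l u : ℂ) (z : Fin n → ℂ) (i k : Fin n) (v : Fin n → ℂ) :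
    ∑ p, form3 l u z i p k * v p =
      l * (conj (z k) * v i + conj (z i) * v k) +
        u * (conj (z i) * conj (z k)) * ∑ p, z p * v p := by
  have : ∀ p, form3 l u z i p k * v p =
      l * conj (z k) * ((1 : Matrix (Fin n) (Fin n) ℂ) i p * v p) +
      l * conj (z i) * ((1 : Matrix (Fin n) (Fin n) ℂ) k p * v p) +
      u * (conj (z i) * conj (z k)) * (z p * v p) := fun q => by
    simp only [form3]; ring
  simp only [this, Finset.sum_add_distrib, ← Finset.mul_sum]
  simp only [Matrix.one_apply, ite_mul, one_mul, zero_mul, Finset.sum_ite_eq, Finset.mem_univ,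
    if_true]
  ring

theorem sum_mul_form2_left (c e : ℂ) (z : Fin n → ℂ) (j : Fin n) :
    ∑ p, z p * form2 c e z p j = (c + nsq z * e) * z j := by
  have : ∀ p, z p * form2 c e z p j = form2 c e z p j * z p := fun p => mul_comm _ _
  simp only [this, sum_form2_mul, sum_conj_mul_self]
  ring

theorem sum_conj_mul_form3 (l u : ℂ) (z : Fin n → ℂ) (i k : Fin n) :
    ∑ q, conj (z q) * form3 l u z i q k = (2 * l + nsq z * u) * (conj (z i) * conj (z k)) := by
  have : ∀ q, conj (z q) * form3 l u z i q k =
      l * conj (z k) * (conj (z q) * (1 : Matrix (Fin n) (Fin n) ℂ) i q) +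
      l * conj (z i) * (conj (z q) * (1 : Matrix (Fin n) (Fin n) ℂ) k q) +
      u * (conj (z i) * conj (z k)) * (conj (z q) * z q) := fun q => by
    simp only [form3]; ring
  simp only [this, Finset.sum_add_distrib, ← Finset.mul_sum, sum_conj_mul_self]
  simp only [Matrix.one_apply, mul_ite, mul_one, mul_zero, Finset.sum_ite_eq, Finset.mem_univ,
    if_true]
  ring

theorem sum_form3bar_mul (l u : ℂ) (z : Fin n → ℂ) (j k : Fin n) :
    ∑ q, z q * form3bar l u z q j k = (2 * l + nsq z * u) * (z j * z k) := by
  have : ∀ q, z q * form3bar l u z q j k =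
      l * z k * (z q * (1 : Matrix (Fin n) (Fin n) ℂ) q j) +
      l * z j * (z q * (1 : Matrix (Fin n) (Fin n) ℂ) q k) +
      u * (z j * z k) * (conj (z q) * z q) := fun q => by
    simp only [form3bar]; ring
  simp only [this, Finset.sum_add_distrib, ← Finset.mul_sum, sum_conj_mul_self]
  simp only [Matrix.one_apply, mul_ite, mul_one, mul_zero, Finset.sum_ite_eq', Finset.mem_univ,
    if_true]
  ring

theorem conj_form2 (c e : ℝ) (z : Fin n → ℂ) (i j : Fin n) :
    conj (form2 c e z i j) = form2 c e z j i := by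
  simp only [form2, map_add, map_mul, Complex.conj_ofReal, Complex.conj_conj, Matrix.one_apply,
    apply_ite conj, map_one, map_zero, eq_comm (a := i)]
  ring

theorem conj_form3 (l u : ℝ) (z : Fin n → ℂ) (i j k : Fin n) :
    conj (form3 l u z i j k) = form3bar l u z j i k := by
  simp only [form3, form3bar, map_add, map_mul, Complex.conj_ofReal, Complex.conj_conj,
    Matrix.one_apply, apply_ite conj, map_one, map_zero, eq_comm (b := j)]
  ring

theorem conj_form4 (α β γ : ℝ) (z : Fin n → ℂ) (i j k l : Fin n) :
    conj (form4 α β β γ z i j k l) = form4 α β β γ z j i l k := by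
  simp only [form4, map_add, map_mul, Complex.conj_ofReal, Complex.conj_conj,
    Matrix.one_apply, apply_ite conj, map_one, map_zero, eq_comm (a := i), eq_comm (a := k)]
  ring

variable {z : Fin n → ℂ} {c e c' e' : ℝ → ℝ}

theorem hasWirtinger_form2 (hc : HasDerivAt c (c' (nsq z)) (nsq z))
    (he : HasDerivAt e (e' (nsq z)) (nsq z)) (i j : Fin n) :
    HasWirtinger (fun w => form2 (c (nsq w)) (e (nsq w)) w i j)
      (fun k => c' (nsq z) * (conj (z k) * (1 : Matrix (Fin n) (Fin n) ℂ) i j) +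
        e (nsq z) * (conj (z i) * (1 : Matrix (Fin n) (Fin n) ℂ) k j) +
        e' (nsq z) * (conj (z i) * conj (z k) * z j))
      (fun k => c' (nsq z) * (z k * (1 : Matrix (Fin n) (Fin n) ℂ) i j) +
        e (nsq z) * (z j * (1 : Matrix (Fin n) (Fin n) ℂ) i k) +
        e' (nsq z) * (conj (z i) * z j * z k)) z := by
  refine (((HasWirtinger.radial hc).mul
    (HasWirtinger.const ((1 : Matrix (Fin n) (Fin n) ℂ) i j))).add
    ((HasWirtinger.radial he).mul (((HasWirtinger.coord i).star).mul
      (HasWirtinger.coord j)))).congr ?_ ?_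
  · funext k; simp only [map_zero]; ring
  · funext k
    simp only [Matrix.one_apply, apply_ite conj, map_one, map_zero, eq_comm (a := i)]; ring

theorem dzbar_form3 (hc : HasDerivAt c (c' (nsq z)) (nsq z))
    (he : HasDerivAt e (e' (nsq z)) (nsq z)) (i j k l : Fin n) :
    dzbar l (fun w => form3 (c (nsq w)) (e (nsq w)) w i j k) z =
      form4 (c (nsq z)) (c' (nsq z)) (e (nsq z)) (e' (nsq z)) z i j k l := by
  have h := ((HasWirtinger.radial hc).mul ((((HasWirtinger.coord k).star).mul
    (HasWirtinger.const ((1 : Matrix (Fin n) (Fin n) ℂ) i j))).add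
    (((HasWirtinger.coord i).star).mul
    (HasWirtinger.const ((1 : Matrix (Fin n) (Fin n) ℂ) k j))))).add
    ((HasWirtinger.radial he).mul ((((HasWirtinger.coord i).star).mul
      ((HasWirtinger.coord k).star)).mul (HasWirtinger.coord j)))
  refine (h.dzbar_eq l).trans ?_
  simp only [form4, Matrix.one_apply, apply_ite conj, map_one, map_zero, eq_comm (a := l)]
  ring

theorem dz_form3bar (hc : HasDerivAt c (c' (nsq z)) (nsq z))
    (he : HasDerivAt e (e' (nsq z)) (nsq z)) (i j k l : Fin n) :
    dz l (fun w => form3bar (c (nsq w)) (e (nsq w)) w i j k) z =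
      form4 (c (nsq z)) (c' (nsq z)) (c' (nsq z)) (e' (nsq z)) z i k l j +
        (e (nsq z) - c' (nsq z)) * ((1 : Matrix (Fin n) (Fin n) ℂ) l j * (conj (z i) * z k) +
          (conj (z i) * z j) * (1 : Matrix (Fin n) (Fin n) ℂ) l k) := by
  have h := ((HasWirtinger.radial hc).mul (((HasWirtinger.coord k).mul
    (HasWirtinger.const ((1 : Matrix (Fin n) (Fin n) ℂ) i j))).add
    ((HasWirtinger.coord j).mul
    (HasWirtinger.const ((1 : Matrix (Fin n) (Fin n) ℂ) i k))))).add
    ((HasWirtinger.radial he).mul ((((HasWirtinger.coord i).star).mul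
      (HasWirtinger.coord j)).mul (HasWirtinger.coord k)))
  refine (h.dz_eq l).trans ?_
  simp only [form4, map_zero]
  ring

end Forms

/-! ### Curvature of a radial metric of constant scalar curvature -/

/-- On the open set `V`, the metric `g` and its Ricci tensor are the ones described by the
profile `S`. -/
structure IsNormalForm {n : ℕ} (V : Set (Fin n → ℂ))
    (g : (Fin n → ℂ) → Matrix (Fin n) (Fin n) ℂ) (S : Profile) : Prop where
  isOpen : IsOpen V
  card : (n : ℝ) = S.m + 1
  solves : ∀ z ∈ V, S.SolvesAt (nsq z)
  metric_eq : ∀ z ∈ V, ∀ i j, g z i j = form2 (S.a (nsq z)) (S.b (nsq z)) z i j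
  ric_eq : ∀ z ∈ V, ∀ i j, ric g i j z = form2 (S.c (nsq z)) (S.e (nsq z)) z i j

namespace Profile

variable (S : Profile)

/-- The coefficient of `δ_{ij}` in the inverse metric. -/
def ia (t : ℝ) : ℝ := t / S.y t

/-- The coefficient of `z̄_i z_j` in the inverse metric. -/
def ib (t : ℝ) : ℝ := -S.s t / S.w t

end Profile

namespace IsNormalForm

variable {n : ℕ} {V : Set (Fin n → ℂ)} {g : (Fin n → ℂ) → Matrix (Fin n) (Fin n) ℂ}
  {S : Profile} (h : IsNormalForm V g S) {z : Fin n → ℂ} (hz : z ∈ V)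
include h hz

theorem eventually_mem : ∀ᶠ w in nhds z, w ∈ V := h.isOpen.mem_nhds hz

theorem inv_eq : (g z)⁻¹ = Matrix.of (form2 (S.ia (nsq z)) (S.ib (nsq z)) z) := by
  have hs := h.solves z hz
  have hP := isProjPair hs.pos
  have hx := hs.pos.ne'
  have hy := hs.y_pos.ne'
  have hw := hs.w_pos.ne'
  have e : g z = Matrix.of (form2 (S.a (nsq z)) (S.b (nsq z)) z) := by
    ext i j; exact h.metric_eq z hz i j
  have ew : S.y (nsq z) * S.s (nsq z) = S.w (nsq z) - 1 := by simp [Profile.w]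
  refine Matrix.inv_eq_right_inv ?_
  rw [e, form2_eq hs.pos, form2_eq hs.pos, hP.mul_lincomb]
  have e1 : ((S.a (nsq z) : ℂ) + nsq z * S.b (nsq z)) *
      (S.ia (nsq z) + nsq z * S.ib (nsq z)) = 1 := by
    have : (S.a (nsq z) + nsq z * S.b (nsq z)) * (S.ia (nsq z) + nsq z * S.ib (nsq z)) = 1 := by
      have a1 : S.a (nsq z) + nsq z * S.b (nsq z) = S.y (nsq z) * S.w (nsq z) / nsq z := by
        simp only [Profile.a, Profile.b, Profile.w]; field_simp
      have a2 : S.ia (nsq z) + nsq z * S.ib (nsq z) = nsq z / (S.y (nsq z) * S.w (nsq z)) := by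
        simp only [Profile.ia, Profile.ib]; field_simp; linarith
      rw [a1, a2]; field_simp
    exact_mod_cast this
  have e2 : (S.a (nsq z) : ℂ) * S.ia (nsq z) = 1 := by
    have : S.a (nsq z) * S.ia (nsq z) = 1 := by
      simp only [Profile.a, Profile.ia]; field_simp
    exact_mod_cast this
  rw [e1, e2, projQ]
  simp

theorem ginv_eq (i j : Fin n) :
    ginv g i j z = form2 (S.ia (nsq z)) (S.ib (nsq z)) z j i := by
  rw [ginv, h.inv_eq hz, Matrix.of_apply]

theorem hasWirtinger_metric (i j : Fin n) :
    HasWirtinger (fun w => g w i j) (fun k => form3 (S.b (nsq z)) (S.b₁ (nsq z)) z i j k)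
      (fun k => form3bar (S.b (nsq z)) (S.b₁ (nsq z)) z i j k) z := by
  have hs := h.solves z hz
  refine ((hasWirtinger_form2 hs.hasDerivAt_a hs.hasDerivAt_b i j).congr ?_ ?_).of_eventuallyEq ?_
  · funext k; simp only [form3]; ring
  · funext k; simp only [form3bar]; ring
  · filter_upwards [h.eventually_mem hz] with w hw using h.metric_eq w hw i j

theorem christoffel_eq (k i p : Fin n) :
    christoffel g k i p z = S.ia (nsq z) * form3 (S.b (nsq z)) (S.b₁ (nsq z)) z i p k +
      S.ib (nsq z) * (2 * S.b (nsq z) + nsq z * S.b₁ (nsq z)) *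
        (conj (z i) * conj (z k) * z p) := by
  simp only [christoffel, h.ginv_eq hz, (h.hasWirtinger_metric hz _ _).dz_eq]
  rw [sum_form2_mul, sum_conj_mul_form3]
  ring

theorem dzbar_metric_eventuallyEq (i j k : Fin n) :
    (fun w => dzbar k (fun v => g v i j) w) =ᶠ[nhds z]
      fun w => form3bar (S.b (nsq w)) (S.b₁ (nsq w)) w i j k := by
  filter_upwards [h.eventually_mem hz] with w hw using (h.hasWirtinger_metric hw i j).dzbar_eq k

theorem curv_eq (i j k l : Fin n) :
    curv g i j k l z = form4 (S.b (nsq z))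
      (S.b₁ (nsq z) - S.ia (nsq z) * S.b (nsq z) ^ 2)
      (S.b₁ (nsq z) - S.ia (nsq z) * S.b (nsq z) ^ 2)
      (S.b₂ (nsq z) - S.ia (nsq z) * (4 * S.b (nsq z) * S.b₁ (nsq z) + nsq z * S.b₁ (nsq z) ^ 2) -
        S.ib (nsq z) * (2 * S.b (nsq z) + nsq z * S.b₁ (nsq z)) ^ 2) z i j k l := by
  have hs := h.solves z hz
  have e1 : dz k (dzbar j fun w => g w i l) z =
      form4 (S.b (nsq z)) (S.b₁ (nsq z)) (S.b₁ (nsq z)) (S.b₂ (nsq z)) z i j k l := by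
    rw [dz_congr (h.dzbar_metric_eventuallyEq hz i l j),
      dz_form3bar hs.hasDerivAt_b hs.hasDerivAt_b₁]
    ring
  have e2 : ∑ p, ∑ q, ginv g q p z * dz k (fun w => g w i p) z * dzbar j (fun w => g w q l) z =
      ∑ p, form3 (S.b (nsq z)) (S.b₁ (nsq z)) z i p k *
        (S.ia (nsq z) * form3bar (S.b (nsq z)) (S.b₁ (nsq z)) z p l j +
          S.ib (nsq z) * conj (z p) *
            ((2 * S.b (nsq z) + nsq z * S.b₁ (nsq z)) * (z l * z j))) := by
    refine Finset.sum_congr rfl fun p _ => ?_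
    rw [← sum_form3bar_mul, Finset.sum_congr rfl fun q _ => mul_comm (z q) _,
      ← sum_mul_form2 _ _ z p fun q => form3bar (S.b (nsq z)) (S.b₁ (nsq z)) z q l j,
      Finset.mul_sum]
    refine Finset.sum_congr rfl fun q _ => ?_
    rw [h.ginv_eq hz, (h.hasWirtinger_metric hz _ _).dz_eq, (h.hasWirtinger_metric hz _ _).dzbar_eq]
    ring
  rw [curv, e1, e2, sum_form3_mul]
  have e3 : ∑ p, z p * ((S.ia (nsq z) : ℂ) * form3bar (S.b (nsq z)) (S.b₁ (nsq z)) z p l j +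
          S.ib (nsq z) * conj (z p) *
            ((2 * S.b (nsq z) + nsq z * S.b₁ (nsq z)) * (z l * z j))) =
      (S.ia (nsq z) + nsq z * S.ib (nsq z)) *
        ((2 * S.b (nsq z) + nsq z * S.b₁ (nsq z)) * (z l * z j)) := by
    have e4 : ∀ p, z p * ((S.ia (nsq z) : ℂ) * form3bar (S.b (nsq z)) (S.b₁ (nsq z)) z p l j +
          S.ib (nsq z) * conj (z p) *
            ((2 * S.b (nsq z) + nsq z * S.b₁ (nsq z)) * (z l * z j))) =
        S.ia (nsq z) * (z p * form3bar (S.b (nsq z)) (S.b₁ (nsq z)) z p l j) +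
          S.ib (nsq z) * ((2 * S.b (nsq z) + nsq z * S.b₁ (nsq z)) * (z l * z j)) *
            (conj (z p) * z p) := fun p => by ring
    simp only [e4, Finset.sum_add_distrib, ← Finset.mul_sum, sum_form3bar_mul, sum_conj_mul_self]
    ring
  rw [e3]
  simp only [form4, form3bar]
  ring

theorem hasWirtinger_ric (i j : Fin n) :
    HasWirtinger (ric g i j) (fun k =>
        S.c₁ (nsq z) * (conj (z k) * (1 : Matrix (Fin n) (Fin n) ℂ) i j) +
        S.e (nsq z) * (conj (z i) * (1 : Matrix (Fin n) (Fin n) ℂ) k j) +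
        S.e₁ (nsq z) * (conj (z i) * conj (z k) * z j))
      (fun k => S.c₁ (nsq z) * (z k * (1 : Matrix (Fin n) (Fin n) ℂ) i j) +
        S.e (nsq z) * (z j * (1 : Matrix (Fin n) (Fin n) ℂ) i k) +
        S.e₁ (nsq z) * (conj (z i) * z j * z k)) z := by
  have hs := h.solves z hz
  refine (hasWirtinger_form2 hs.hasDerivAt_c hs.hasDerivAt_e i j).of_eventuallyEq ?_
  filter_upwards [h.eventually_mem hz] with w hw using h.ric_eq w hw i j

omit h hz in
theorem _root_.TYZ.Profile.SolvesAt.kappa_eq {S : Profile} {t : ℝ} (hs : S.SolvesAt t) :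
    S.κ = S.X t + S.Y t - (S.w t - 1) / S.y t := by
  have := hs.y_pos.ne'
  simp only [Profile.w, Profile.s]; field_simp; ring

theorem ricD_eq (i j k : Fin n) :
    ricD g i j k z = form3 (S.l (nsq z)) (S.u (nsq z)) z i j k := by
  have hs := h.solves z hz
  have hx := hs.pos.ne'
  have hy := hs.y_pos.ne'
  have hw := hs.w_pos.ne'
  have hk := hs.kappa_eq
  have e1 : ∑ p, christoffel g k i p z * ric g p j z =
      S.ia (nsq z) * ∑ p, form3 (S.b (nsq z)) (S.b₁ (nsq z)) z i p k *
          form2 (S.c (nsq z)) (S.e (nsq z)) z p j +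
        S.ib (nsq z) * (2 * S.b (nsq z) + nsq z * S.b₁ (nsq z)) * (conj (z i) * conj (z k)) *
          ∑ p, z p * form2 (S.c (nsq z)) (S.e (nsq z)) z p j := by
    rw [Finset.mul_sum, Finset.mul_sum, ← Finset.sum_add_distrib]
    refine Finset.sum_congr rfl fun p _ => ?_
    rw [h.christoffel_eq hz, h.ric_eq z hz]; ring
  have c1 : S.c₁ (nsq z) - S.ia (nsq z) * S.b (nsq z) * S.c (nsq z) = S.l (nsq z) := by
    simp only [Profile.c₁, Profile.ia, Profile.b, Profile.c, Profile.l, Profile.rQ, Profile.s]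
    generalize nsq z = t at *
    rw [hk]; field_simp; ring
  have c2 : S.e (nsq z) - S.ia (nsq z) * S.b (nsq z) * S.c (nsq z) = S.l (nsq z) := by
    simp only [Profile.e, Profile.ia, Profile.b, Profile.c, Profile.l, Profile.rQ, Profile.rP,
      Profile.s]
    generalize nsq z = t at *
    rw [hk]; field_simp; ring
  have c3 : S.e₁ (nsq z) - 2 * S.ia (nsq z) * S.b (nsq z) * S.e (nsq z) -
      (S.ia (nsq z) * S.b₁ (nsq z) +
        S.ib (nsq z) * (2 * S.b (nsq z) + nsq z * S.b₁ (nsq z))) *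
        (S.c (nsq z) + nsq z * S.e (nsq z)) = S.u (nsq z) := by
    simp only [Profile.e, Profile.ia, Profile.b, Profile.c, Profile.u, Profile.rQ, Profile.rP,
      Profile.s, Profile.e₁, Profile.ib, Profile.b₁, Profile.τ]
    generalize nsq z = t at *
    rw [hk]; field_simp; ring
  have c1' : (S.c₁ (nsq z) : ℂ) - S.ia (nsq z) * S.b (nsq z) * S.c (nsq z) = S.l (nsq z) := by
    exact_mod_cast c1
  have c2' : (S.e (nsq z) : ℂ) - S.ia (nsq z) * S.b (nsq z) * S.c (nsq z) = S.l (nsq z) := by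
    exact_mod_cast c2
  have c3' : (S.e₁ (nsq z) : ℂ) - 2 * S.ia (nsq z) * S.b (nsq z) * S.e (nsq z) -
      (S.ia (nsq z) * S.b₁ (nsq z) +
        S.ib (nsq z) * (2 * S.b (nsq z) + nsq z * S.b₁ (nsq z))) *
        (S.c (nsq z) + nsq z * S.e (nsq z)) = S.u (nsq z) := by
    exact_mod_cast c3
  rw [ricD, e1, sum_form3_mul, sum_mul_form2_left, (h.hasWirtinger_ric hz i j).dz_eq]
  simp only [form3, form2]
  linear_combination (conj (z k) * (1 : Matrix (Fin n) (Fin n) ℂ) i j) * c1' +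
    (conj (z i) * (1 : Matrix (Fin n) (Fin n) ℂ) k j) * c2' +
    (conj (z i) * conj (z k) * z j) * c3'

theorem ricDD_eq (i j k l : Fin n) :
    ricDD g i j k l z = form4 (S.l (nsq z))
      (S.l₁ (nsq z) - S.ia (nsq z) * S.b (nsq z) * S.l (nsq z))
      (S.u (nsq z) - S.ia (nsq z) * S.b (nsq z) * S.l (nsq z))
      (S.u₁ (nsq z) - S.ia (nsq z) * (2 * S.l (nsq z) * S.b₁ (nsq z) +
          S.u (nsq z) * (2 * S.b (nsq z) + nsq z * S.b₁ (nsq z))) -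
        S.ib (nsq z) * (2 * S.b (nsq z) + nsq z * S.b₁ (nsq z)) *
          (2 * S.l (nsq z) + nsq z * S.u (nsq z))) z i j k l := by
  have hs := h.solves z hz
  have e0 : ricD g i j k =ᶠ[nhds z] fun w => form3 (S.l (nsq w)) (S.u (nsq w)) w i j k := by
    filter_upwards [h.eventually_mem hz] with w hw using h.ricD_eq hw i j k
  have e1 : ∑ p, conj (christoffel g l j p z) * ricD g i p k z =
      S.ia (nsq z) * ∑ p, form3 (S.l (nsq z)) (S.u (nsq z)) z i p k *
        form3bar (S.b (nsq z)) (S.b₁ (nsq z)) z p j l +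
      S.ib (nsq z) * (2 * S.b (nsq z) + nsq z * S.b₁ (nsq z)) * (z j * z l) *
        ∑ p, conj (z p) * form3 (S.l (nsq z)) (S.u (nsq z)) z i p k := by
    rw [Finset.mul_sum, Finset.mul_sum, ← Finset.sum_add_distrib]
    refine Finset.sum_congr rfl fun p _ => ?_
    rw [h.christoffel_eq hz, h.ricD_eq hz, map_add, map_mul, conj_form3]
    simp only [map_mul, map_add, Complex.conj_ofReal, Complex.conj_conj, map_ofNat]
    ring
  rw [ricDD, dzbar_congr e0, dzbar_form3 hs.hasDerivAt_l hs.hasDerivAt_u, e1, sum_form3_mul,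
    sum_form3bar_mul, sum_conj_mul_form3]
  simp only [form4, form3bar]
  ring

end IsNormalForm

/-! ### The coefficients of a metric of constant scalar curvature -/

section Constant

variable {n : ℕ} {V : Set (Fin n → ℂ)} {f : (Fin n → ℂ) → ℂ} {c : ℂ} {z : Fin n → ℂ}

theorem dzbar_eq_zero_of_const (hV : IsOpen V) (hf : ∀ z ∈ V, f z = c) (hz : z ∈ V) (i : Fin n) :
    dzbar i f z = 0 := by
  refine (HasWirtinger.of_eventuallyEq (HasWirtinger.const c) ?_).dzbar_eq i
  filter_upwards [hV.mem_nhds hz] with w hw using hf w hw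

theorem dz_eq_zero_of_const (hV : IsOpen V) (hf : ∀ z ∈ V, f z = c) (hz : z ∈ V) (i : Fin n) :
    dz i f z = 0 := by
  refine (HasWirtinger.of_eventuallyEq (HasWirtinger.const c) ?_).dz_eq i
  filter_upwards [hV.mem_nhds hz] with w hw using hf w hw

theorem dz_dzbar_eq_zero_of_const (hV : IsOpen V) (hf : ∀ z ∈ V, f z = c) (hz : z ∈ V)
    (i j : Fin n) : dz i (dzbar j f) z = 0 :=
  dz_eq_zero_of_const hV (fun _ hw => dzbar_eq_zero_of_const hV hf hw j) hz i

theorem lap_eq_zero_of_const (g : (Fin n → ℂ) → Matrix (Fin n) (Fin n) ℂ) (hV : IsOpen V)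
    (hf : ∀ z ∈ V, f z = c) (hz : z ∈ V) : lap g f z = 0 := by
  simp [lap, dz_dzbar_eq_zero_of_const hV hf hz]

/-- The contraction of the second covariant derivative of the Ricci tensor with the curvature
tensor. -/
def ricDDCurv (g : (Fin n → ℂ) → Matrix (Fin n) (Fin n) ℂ) (z : Fin n → ℂ) : ℂ :=
  ∑ i, ∑ j, ∑ k, ∑ l, ∑ a, ∑ b, ∑ c, ∑ d,
      ginv g i a z * ginv g b j z * ginv g k c z * ginv g d l z *
        ricDD g i j k l z * curv g b a d c z

theorem a2_eq_of_scal_const {g : (Fin n → ℂ) → Matrix (Fin n) (Fin n) ℂ} (hV : IsOpen V)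
    (hs : ∀ z ∈ V, scal g z = c) (hz : z ∈ V) :
    24 * a2 g z = normSqCurv g z - 4 * normSqRic g z + 3 * c ^ 2 := by
  rw [a2, lap_eq_zero_of_const g hV hs hz, hs z hz]; ring

theorem a3_eq_of_scal_const {g : (Fin n → ℂ) → Matrix (Fin n) (Fin n) ℂ} (hV : IsOpen V)
    (hs : ∀ z ∈ V, scal g z = c) (hz : z ∈ V) :
    48 * a3 g z = 2 * ricDDCurv g z - 4 * normSqDRic g z - 4 * curvRicRic g z -
      2 * ricCurvCurv g z +
      lap g (fun w => normSqCurv g w - 4 * normSqRic g w + 8 * scal g w ^ 2) z +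
      c * (c ^ 2 - 4 * normSqRic g z + normSqCurv g z) := by
  have h1 : lap g (lap g (scal g)) z = 0 :=
    lap_eq_zero_of_const g hV (fun w hw => lap_eq_zero_of_const g hV hs hw) hz
  have h2 : ricHessScal g z = 0 := by
    simp [ricHessScal, dz_dzbar_eq_zero_of_const hV hs hz]
  have h3 : divdivScalRic g z = 0 := by
    simp [divdivScalRic, h2, lap_eq_zero_of_const g hV hs hz, normSqDScal,
      dz_eq_zero_of_const hV hs hz]
  rw [a3, h1, h3, divdivCurvRic, h2, ← ricDDCurv, hs z hz]
  ring

end Constant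

namespace Profile

variable (S : Profile)

/-- The holomorphic sectional curvature of the radial direction. It is `-R_{11̄11̄}` in a unitary
frame, as the sign convention for `curv` makes it negative on positively curved metrics. -/
def kA (t : ℝ) : ℝ := 2 * S.κ - S.m * (S.m - 1) * S.X t - S.m * (S.m + 1) * S.Y t

/-- The bisectional curvature of the radial direction and one orthogonal to it. -/
def kB (t : ℝ) : ℝ := S.κ + S.m * S.X t + (S.m + 1) * S.Y t

/-- The bisectional curvature of two orthogonal directions, both orthogonal to the radial one. -/
def kC (t : ℝ) : ℝ := S.κ - S.X t - S.Y t

/-- `|R|²`. -/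
def normR (t : ℝ) : ℝ :=
  S.kA t ^ 2 + 4 * S.m * S.kB t ^ 2 + 2 * S.m * (S.m + 1) * S.kC t ^ 2

/-- `|Ric|²`. -/
def normRic (t : ℝ) : ℝ := S.rP t ^ 2 + S.m * S.rQ t ^ 2

/-- The coefficient of `Q_{ij} P_{kl} + P_{il} Q_{kj}` in the second covariant derivative of the
Ricci tensor. -/
def dB (t : ℝ) : ℝ :=
  S.X t * (S.m + 1) * (-(S.m + 1) / S.y t + S.m * S.κ - 2 * (S.m + 1) * S.Y t -
    (2 * S.m + 1) * S.X t)

/-- The coefficient of `Q_{ij} Q_{kl} + Q_{il} Q_{kj}` in the second covariant derivative of the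
Ricci tensor. -/
def dC (t : ℝ) : ℝ := (S.m + 1) * S.X t * S.w t / S.y t

/-- The value of `ricDDCurv`. -/
def ddR (t : ℝ) : ℝ :=
  -(-S.m * S.dB t * S.kA t + 2 * S.m * (S.dB t - (S.m + 1) * S.dC t) * S.kB t +
    2 * S.m * (S.m + 1) * S.dC t * S.kC t)

/-- `|D'Ric|²`. -/
def normDRic (t : ℝ) : ℝ :=
  (S.m + 1) ^ 2 * S.m * (S.m + 2) * S.X t ^ 2 * S.w t / S.y t

/-- `R(Ric, Ric)`. -/
def rRicRic (t : ℝ) : ℝ :=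
  -(S.kA t * S.rP t ^ 2 + 2 * S.m * S.kB t * S.rP t * S.rQ t +
    S.m * (S.m + 1) * S.kC t * S.rQ t ^ 2)

/-- `Ric(R, R)`. -/
def ricRR (t : ℝ) : ℝ :=
  S.rP t * (S.kA t ^ 2 + 2 * S.m * S.kB t ^ 2) +
    S.m * S.rQ t * (2 * S.kB t ^ 2 + 2 * (S.m + 1) * S.kC t ^ 2)

end Profile

namespace IsNormalForm

variable {n : ℕ} {V : Set (Fin n → ℂ)} {g : (Fin n → ℂ) → Matrix (Fin n) (Fin n) ℂ}
  {S : Profile} (h : IsNormalForm V g S) {z : Fin n → ℂ} (hz : z ∈ V)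
include h hz

theorem projPair : IsProjPair (projP z) (projQ z) (S.m : ℂ) := by
  have := isProjPair (h.solves z hz).pos
  have e : (n : ℂ) - 1 = S.m := by
    have := h.card
    have : (n : ℝ) - 1 = S.m := by linarith
    exact_mod_cast this
  rwa [e] at this

theorem inv_eq_proj : (g z)⁻¹ =
    ((nsq z / (S.y (nsq z) * S.w (nsq z)) : ℝ) : ℂ) • projP z +
      ((nsq z / S.y (nsq z) : ℝ) : ℂ) • projQ z := by
  have hs := h.solves z hz
  have hx := hs.pos.ne'
  have hy := hs.y_pos.ne'
  have hw := hs.w_pos.ne'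
  have ew : S.y (nsq z) * S.s (nsq z) = S.w (nsq z) - 1 := by simp [Profile.w]
  have a2 : S.ia (nsq z) + nsq z * S.ib (nsq z) = nsq z / (S.y (nsq z) * S.w (nsq z)) := by
    simp only [Profile.ia, Profile.ib]; field_simp; linarith
  rw [h.inv_eq hz, form2_eq hs.pos, ← a2, Profile.ia]
  push_cast
  rfl

theorem ric_mul_inv : Matrix.of (fun i j => ric g i j z) * (g z)⁻¹ =
    (S.rP (nsq z) : ℂ) • projP z + (S.rQ (nsq z) : ℂ) • projQ z := by
  have hs := h.solves z hz
  have hx := hs.pos.ne'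
  have hy := hs.y_pos.ne'
  have hw := hs.w_pos.ne'
  have e : Matrix.of (fun i j => ric g i j z) =
      Matrix.of (form2 (S.c (nsq z)) (S.e (nsq z)) z) := by
    ext i j; exact h.ric_eq z hz i j
  rw [e, form2_eq hs.pos, h.inv_eq_proj hz, (h.projPair hz).mul_lincomb]
  congr 2
  · rw [← Complex.ofReal_mul, ← Complex.ofReal_add, ← Complex.ofReal_mul]
    congr 1
    simp only [Profile.c, Profile.e]; field_simp; ring
  · rw [← Complex.ofReal_mul]
    congr 1
    simp only [Profile.c]; field_simp

theorem mix_curv : mix (g z)⁻¹ (fun i j k l => curv g i j k l z) =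
    tensorK (projP z) (projQ z) (-S.kA (nsq z) : ℝ) (-S.kB (nsq z) : ℝ) (-S.kB (nsq z) : ℝ)
      (-S.kC (nsq z) : ℝ) := by
  have hs := h.solves z hz
  have hx := hs.pos.ne'
  have hy := hs.y_pos.ne'
  have hw := hs.w_pos.ne'
  have hk := hs.kappa_eq
  have e := funext fun i => funext fun j => funext fun k => funext fun l => h.curv_eq hz i j k l
  rw [e]
  change mix _ (form4 _ _ _ _ z) = _
  rw [form4_eq hs.pos, h.inv_eq_proj hz, (h.projPair hz).mix_tensorK]
  have eB : (S.b (nsq z) + nsq z * (S.b₁ (nsq z) - S.ia (nsq z) * S.b (nsq z) ^ 2)) *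
      (nsq z / (S.y (nsq z) * S.w (nsq z))) * (nsq z / S.y (nsq z)) = -S.kB (nsq z) := by
    simp only [Profile.kB, Profile.b, Profile.b₁, Profile.ia, Profile.s, Profile.τ]
    generalize nsq z = t at *
    rw [hk]; field_simp; ring
  congr 1
  · have : (2 * S.b (nsq z) + 2 * nsq z * (S.b₁ (nsq z) - S.ia (nsq z) * S.b (nsq z) ^ 2) +
        2 * nsq z * (S.b₁ (nsq z) - S.ia (nsq z) * S.b (nsq z) ^ 2) +
        nsq z ^ 2 * (S.b₂ (nsq z) - S.ia (nsq z) *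
          (4 * S.b (nsq z) * S.b₁ (nsq z) + nsq z * S.b₁ (nsq z) ^ 2) -
          S.ib (nsq z) * (2 * S.b (nsq z) + nsq z * S.b₁ (nsq z)) ^ 2)) *
        (nsq z / (S.y (nsq z) * S.w (nsq z))) * (nsq z / (S.y (nsq z) * S.w (nsq z))) =
        -S.kA (nsq z) := by
      simp only [Profile.kA, Profile.b, Profile.b₁, Profile.b₂, Profile.ia, Profile.ib, Profile.s,
        Profile.τ, Profile.τ₂]
      generalize nsq z = t at *
      rw [hk]; field_simp; ring
    rw [← this]; push_cast; ring
  · rw [← eB]; push_cast; ring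
  · rw [← eB]; push_cast; ring
  · have : S.b (nsq z) * (nsq z / S.y (nsq z)) * (nsq z / S.y (nsq z)) = -S.kC (nsq z) := by
      simp only [Profile.kC, Profile.b, Profile.s]
      field_simp; ring
    rw [← this]; push_cast; ring

theorem mix_ricDD : mix (g z)⁻¹ (fun i j k l => ricDD g i j k l z) =
    tensorK (projP z) (projQ z) (-S.m * S.dB (nsq z) : ℝ) (S.dB (nsq z) : ℝ)
      (-((S.m + 1) * S.dC (nsq z)) : ℝ) (S.dC (nsq z) : ℝ) := by
  have hs := h.solves z hz
  have hx := hs.pos.ne'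
  have hy := hs.y_pos.ne'
  have hw := hs.w_pos.ne'
  have hk := hs.kappa_eq
  have e := funext fun i => funext fun j => funext fun k => funext fun l => h.ricDD_eq hz i j k l
  rw [e]
  change mix _ (form4 _ _ _ _ z) = _
  rw [form4_eq hs.pos, h.inv_eq_proj hz, (h.projPair hz).mix_tensorK]
  congr 1
  · have : (2 * S.l (nsq z) +
        2 * nsq z * (S.l₁ (nsq z) - S.ia (nsq z) * S.b (nsq z) * S.l (nsq z)) +
        2 * nsq z * (S.u (nsq z) - S.ia (nsq z) * S.b (nsq z) * S.l (nsq z)) +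
        nsq z ^ 2 * (S.u₁ (nsq z) - S.ia (nsq z) * (2 * S.l (nsq z) * S.b₁ (nsq z) +
          S.u (nsq z) * (2 * S.b (nsq z) + nsq z * S.b₁ (nsq z))) -
        S.ib (nsq z) * (2 * S.b (nsq z) + nsq z * S.b₁ (nsq z)) *
          (2 * S.l (nsq z) + nsq z * S.u (nsq z)))) *
        (nsq z / (S.y (nsq z) * S.w (nsq z))) * (nsq z / (S.y (nsq z) * S.w (nsq z))) =
        -S.m * S.dB (nsq z) := by
      simp only [Profile.dB, Profile.b, Profile.b₁, Profile.l, Profile.l₁, Profile.u, Profile.u₁,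
        Profile.ia, Profile.ib, Profile.s, Profile.τ]
      generalize nsq z = t at *
      rw [hk]; field_simp; ring
    rw [← this]; push_cast; ring
  · have : (S.l (nsq z) +
        nsq z * (S.l₁ (nsq z) - S.ia (nsq z) * S.b (nsq z) * S.l (nsq z))) *
        (nsq z / (S.y (nsq z) * S.w (nsq z))) * (nsq z / S.y (nsq z)) = S.dB (nsq z) := by
      simp only [Profile.dB, Profile.b, Profile.l, Profile.l₁, Profile.ia, Profile.s, Profile.τ]
      generalize nsq z = t at *
      rw [hk]; field_simp; ring
    rw [← this]; push_cast; ring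
  · have : (S.l (nsq z) +
        nsq z * (S.u (nsq z) - S.ia (nsq z) * S.b (nsq z) * S.l (nsq z))) *
        (nsq z / (S.y (nsq z) * S.w (nsq z))) * (nsq z / S.y (nsq z)) =
        -((S.m + 1) * S.dC (nsq z)) := by
      simp only [Profile.dC, Profile.b, Profile.l, Profile.u, Profile.ia, Profile.s]
      generalize nsq z = t at *
      rw [hk]; field_simp; ring
    rw [← this]; push_cast; ring
  · have : S.l (nsq z) * (nsq z / S.y (nsq z)) * (nsq z / S.y (nsq z)) = S.dC (nsq z) := by
      simp only [Profile.dC, Profile.l]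
      field_simp
    rw [← this]; push_cast; ring

theorem scal_eq : scal g z = ((S.m + 1) * (S.m + 2) * S.κ : ℝ) := by
  have e : scal g z = (Matrix.of (fun i j => ric g i j z) * (g z)⁻¹).trace := by
    simp only [scal, ginv, Matrix.trace, Matrix.diag, Matrix.mul_apply, Matrix.of_apply]
    exact Finset.sum_congr rfl fun _ _ => Finset.sum_congr rfl fun _ _ => mul_comm _ _
  rw [e, h.ric_mul_inv hz, (h.projPair hz).trace_lincomb]
  simp only [Profile.rP, Profile.rQ]; push_cast; ring

theorem normSqRic_eq : normSqRic g z = S.normRic (nsq z) := by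
  have e : normSqRic g z = (Matrix.of (fun i j => ric g i j z) * (g z)⁻¹ *
      (Matrix.of (fun i j => ric g i j z) * (g z)⁻¹)).trace := by
    rw [← sum_four_eq_trace]
    simp only [normSqRic, ginv, Matrix.of_apply, h.ric_eq z hz, conj_form2]
  rw [e, h.ric_mul_inv hz, (h.projPair hz).mul_lincomb, (h.projPair hz).trace_lincomb]
  simp only [Profile.normRic]; push_cast; ring

theorem conj_curv (i j k l : Fin n) : conj (curv g i j k l z) = curv g j i l k z := by
  have := conj_form4 (S.b (nsq z)) (S.b₁ (nsq z) - S.ia (nsq z) * S.b (nsq z) ^ 2)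
    (S.b₂ (nsq z) - S.ia (nsq z) * (4 * S.b (nsq z) * S.b₁ (nsq z) + nsq z * S.b₁ (nsq z) ^ 2) -
        S.ib (nsq z) * (2 * S.b (nsq z) + nsq z * S.b₁ (nsq z)) ^ 2) z i j k l
  push_cast at this
  rw [h.curv_eq hz, h.curv_eq hz, this]

theorem normSqCurv_eq : normSqCurv g z = S.normR (nsq z) := by
  have e : normSqCurv g z = (pair (mix (g z)⁻¹ (fun i j k l => curv g i j k l z))
      (mix (g z)⁻¹ (fun i j k l => curv g i j k l z))).trace := by
    rw [← sum_eight_eq_trace_pair]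
    simp only [normSqCurv, ginv, h.conj_curv hz]
  rw [e, h.mix_curv hz, (h.projPair hz).trace_pair_tensorK]
  simp only [Profile.normR]; push_cast; ring

theorem ricDDCurv_eq : ricDDCurv g z = S.ddR (nsq z) := by
  have e : ricDDCurv g z = (pair (mix (g z)⁻¹ (fun i j k l => ricDD g i j k l z))
      (mix (g z)⁻¹ (fun i j k l => curv g i j k l z))).trace := by
    rw [← sum_eight_eq_trace_pair]
    simp only [ricDDCurv, ginv]
  rw [e, h.mix_curv hz, h.mix_ricDD hz, (h.projPair hz).trace_pair_tensorK]
  simp only [Profile.ddR]; push_cast; ring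

theorem curvRicRic_eq : curvRicRic g z = S.rRicRic (nsq z) := by
  have e : curvRicRic g z = (pair (mix (g z)⁻¹ (fun i j k l => curv g i j k l z))
      (mix (g z)⁻¹ (tensorE (Matrix.of fun i j => ric g i j z)
        (Matrix.of fun i j => ric g i j z)))).trace := by
    rw [← sum_eight_eq_trace_pair]
    unfold curvRicRic
    iterate 8 refine Finset.sum_congr rfl fun _ _ => ?_
    exact mul_assoc _ _ _
  rw [e, h.mix_curv hz, mix_tensorE, h.ric_mul_inv hz,
    (h.projPair hz).trace_pair_tensorK_tensorE]
  simp only [Profile.rRicRic]; push_cast; ring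

theorem ricCurvCurv_eq : ricCurvCurv g z = S.ricRR (nsq z) := by
  have e : ricCurvCurv g z = (Matrix.of (fun i j => ric g i j z) * (g z)⁻¹ *
      pair (mix (g z)⁻¹ (fun i j k l => curv g i j k l z))
      (mix (g z)⁻¹ (fun i j k l => curv g i j k l z))).trace := by
    rw [← sum_ten_eq_trace]
    rfl
  rw [e, h.mix_curv hz, h.ric_mul_inv hz, (h.projPair hz).pair_tensorK,
    (h.projPair hz).mul_lincomb, (h.projPair hz).trace_lincomb]
  simp only [Profile.ricRR]; push_cast; ring

theorem normSqDRic_eq : normSqDRic g z = S.normDRic (nsq z) := by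
  have hs := h.solves z hz
  have hx := hs.pos.ne'
  have hy := hs.y_pos.ne'
  have hw := hs.w_pos.ne'
  have hP := h.projPair hz
  set M : Matrix (Fin n) (Fin n) ℂ := ((S.l (nsq z) + nsq z * S.u (nsq z) / 2 : ℝ) : ℂ) • projP z +
    (S.l (nsq z) : ℂ) • projQ z with hM
  have eD : ∀ i j k, ricD g i j k z = tensorF (fun i => conj (z i)) M i j k := fun i j k => by
    rw [h.ricD_eq hz, form3_eq hs.pos, hM]; push_cast; rfl
  have eD' : ∀ a b c, conj (ricD g a b c z) = z c * M b a + z a * M b c := fun a b c => by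
    have : ∀ i j, conj (M i j) = M j i := fun i j => by
      have e : M = Matrix.of (form2 (S.l (nsq z)) ((S.u (nsq z) / 2 : ℝ) : ℂ) z) := by
        rw [hM, form2_eq hs.pos]; push_cast; congr 2; ring
      rw [e]
      exact conj_form2 _ _ _ _ _
    rw [eD, tensorF, map_add, map_mul, map_mul, this, this]; simp
  have e : normSqDRic g z = 2 * ((Matrix.vecMul z (g z)⁻¹ ⬝ᵥ fun i => conj (z i)) *
      (M * (g z)⁻¹ * (M * (g z)⁻¹)).trace + Matrix.vecMul z (g z)⁻¹ ⬝ᵥ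
        (Matrix.mulVec (M * (g z)⁻¹ * (M * (g z)⁻¹)) fun i => conj (z i))) := by
    rw [← sum_six_tensorF]
    simp only [normSqDRic, ginv, eD']
    simp only [eD]
  have hx' : (nsq z : ℂ) ≠ 0 := by exact_mod_cast hx
  have zP : Matrix.vecMul z (projP z) = z := by
    funext j
    have : ∀ i, z i * (conj (z i) * z j / nsq z) = conj (z i) * z i * (z j / nsq z) :=
      fun i => by ring
    simp only [Matrix.vecMul, dotProduct, projP, Matrix.of_apply, this, ← Finset.sum_mul,
      sum_conj_mul_self]
    field_simp
  have Pz : Matrix.mulVec (projP z) (fun i => conj (z i)) = fun i => conj (z i) := by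
    funext i
    have : ∀ j, conj (z i) * z j / nsq z * conj (z j) = conj (z j) * z j * (conj (z i) / nsq z) :=
      fun i => by ring
    simp only [Matrix.mulVec, dotProduct, projP, Matrix.of_apply, this, ← Finset.sum_mul,
      sum_conj_mul_self]
    field_simp
  have zQ : Matrix.vecMul z (projQ z) = 0 := by rw [projQ, Matrix.vecMul_sub, zP]; simp
  have Qz : Matrix.mulVec (projQ z) (fun i => conj (z i)) = 0 := by
    rw [projQ, Matrix.sub_mulVec, Pz]; simp
  have zz : z ⬝ᵥ (fun i => conj (z i)) = (nsq z : ℂ) := by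
    rw [← sum_conj_mul_self, dotProduct]; exact Finset.sum_congr rfl fun _ _ => mul_comm _ _
  rw [e, hM, h.inv_eq_proj hz, hP.mul_lincomb, hP.mul_lincomb, hP.trace_lincomb]
  simp only [Matrix.vecMul_add, Matrix.vecMul_smul, Matrix.add_mulVec, Matrix.smul_mulVec, zP, Pz,
    zQ, Qz, smul_zero, add_zero, smul_dotProduct, dotProduct_smul, zz, smul_eq_mul]
  have hp : (S.l (nsq z) + nsq z * S.u (nsq z) / 2) =
      -(S.m * (S.m + 1) * S.y (nsq z) * S.w (nsq z) ^ 2 * S.X (nsq z) / (2 * nsq z ^ 2)) := by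
    simp only [Profile.l, Profile.u]; field_simp; ring
  rw [hp]
  norm_cast
  simp only [Profile.normDRic, Profile.l]
  field_simp
  ring

omit h hz in
theorem _root_.TYZ.lap_congr {g : (Fin n → ℂ) → Matrix (Fin n) (Fin n) ℂ}
    {f₁ f₂ : (Fin n → ℂ) → ℂ} {z : Fin n → ℂ}
    (hf : f₁ =ᶠ[nhds z] f₂) : lap g f₁ z = lap g f₂ z := by
  have : ∀ i j, dz i (dzbar j f₁) z = dz i (dzbar j f₂) z := fun i j =>
    dz_congr (hf.eventuallyEq_nhds.mono fun w hw => dzbar_congr hw)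
  simp only [lap, this]

/-- The Laplacian of a radial function. -/
theorem lap_radial {f f₁ f₂ : ℝ → ℝ}
    (hf : ∀ w ∈ V, HasDerivAt f (f₁ (nsq w)) (nsq w))
    (hf₁ : HasDerivAt f₁ (f₂ (nsq z)) (nsq z)) :
    lap g (fun w => (f (nsq w) : ℂ)) z =
      ((S.m * f₁ (nsq z) + (f₁ (nsq z) + nsq z * f₂ (nsq z)) / S.w (nsq z)) *
        (nsq z / S.y (nsq z)) : ℝ) := by
  have hs := h.solves z hz
  have hw := hs.w_pos.ne'
  have hy := hs.y_pos.ne'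
  have e1 : ∀ i j, dz i (dzbar j fun w => (f (nsq w) : ℂ)) z =
      form2 (f₁ (nsq z)) (f₂ (nsq z)) z i j := fun i j => by
    have : (dzbar j fun w => (f (nsq w) : ℂ)) =ᶠ[nhds z] fun w => f₁ (nsq w) * w j := by
      filter_upwards [h.eventually_mem hz] with w hw
        using (HasWirtinger.radial (hf w hw)).dzbar_eq j
    rw [dz_congr this]
    refine (((HasWirtinger.radial hf₁).mul (HasWirtinger.coord j)).dz_eq i).trans ?_
    simp only [form2]; ring
  have e : lap g (fun w => (f (nsq w) : ℂ)) z =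
      (Matrix.of (form2 (f₁ (nsq z)) (f₂ (nsq z)) z) * (g z)⁻¹).trace := by
    simp only [lap, ginv, Matrix.trace, Matrix.diag, Matrix.mul_apply, Matrix.of_apply, e1]
    exact Finset.sum_congr rfl fun _ _ => Finset.sum_congr rfl fun _ _ => mul_comm _ _
  rw [e, form2_eq hs.pos, h.inv_eq_proj hz, (h.projPair hz).mul_lincomb,
    (h.projPair hz).trace_lincomb]
  norm_cast
  field_simp
  ring

end IsNormalForm

/-! ### The second and third coefficients along a profile -/

namespace Profile

variable (S : Profile) {t : ℝ}

/-- The non-constant part of `a₂`, up to a positive factor. -/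
def quad (t : ℝ) : ℝ :=
  (S.m - 1) * S.X t ^ 2 + 2 * (S.m + 1) * (S.X t * S.Y t) + (S.m + 3) * S.Y t ^ 2

/-- `-x quad' / w`. -/
def quad₁ (t : ℝ) : ℝ :=
  2 * (S.m + 1) * (S.m - 1) * S.X t ^ 2 + 2 * (S.m + 1) * (2 * S.m + 3) * (S.X t * S.Y t) +
    2 * (S.m + 2) * (S.m + 3) * S.Y t ^ 2

/-- `-x quad₁' / w`. -/
def quad₂ (t : ℝ) : ℝ :=
  4 * (S.m + 1) ^ 2 * (S.m - 1) * S.X t ^ 2 +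
    2 * (S.m + 1) * (2 * S.m + 3) ^ 2 * (S.X t * S.Y t) +
    4 * (S.m + 2) ^ 2 * (S.m + 3) * S.Y t ^ 2

/-- The non-constant part of `a₃`, up to a positive factor. -/
def cubic (t : ℝ) : ℝ :=
  (2 * (S.m + 1) * (S.m + 3) * (S.m - 1) * S.X t ^ 2 +
      4 * (S.m + 1) * (S.m + 2) * (S.m + 3) * S.X t * S.Y t +
      2 * (S.m + 2) * (S.m + 3) * (S.m + 4) * S.Y t ^ 2) / S.y t -
    S.κ * ((S.m + 1) * (S.m + 4) * (S.m - 1) * S.X t ^ 2 +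
      (10 + 2 * S.m) * (S.m + 1) * (S.m + 2) * S.X t * S.Y t +
      (S.m + 7) * (S.m + 2) * (S.m + 3) * S.Y t ^ 2) +
    2 * (S.m + 1) * (S.m - 1) * (2 * S.m + 3) * S.X t ^ 3 +
    6 * (S.m + 1) ^ 2 * (2 * S.m + 3) * S.X t ^ 2 * S.Y t +
    (42 + 42 * S.m + 12 * S.m ^ 2) * (S.m + 2) * S.X t * S.Y t ^ 2 +
    2 * (S.m + 2) * (S.m + 3) * (2 * S.m + 5) * S.Y t ^ 3

/-- The factor `m (m + 1) (m + 2)` of `quad` and `cubic` in `a₂` and `a₃`. -/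
def cf : ℝ := S.m * (S.m + 1) * (S.m + 2)

/-- `|R|² - 4 |Ric|²` along a profile. -/
theorem normR_sub_normRic (t : ℝ) :
    S.normR t - 4 * S.normRic t =
      -((S.m + 1) * (S.m + 2) * (4 * S.m + 6) * S.κ ^ 2) + S.cf * S.quad t := by
  simp only [normR, normRic, kA, kB, kC, rP, rQ, cf, quad]; ring

variable {S}

theorem SolvesAt.hasDerivAt_quad (h : S.SolvesAt t) :
    HasDerivAt S.quad (-(S.w t * S.quad₁ t / t)) t := by
  refine ((((h.hX.pow 2).const_mul (S.m - 1)).add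
    ((h.hX.mul h.hY).const_mul (2 * (S.m + 1)))).add
    ((h.hY.pow 2).const_mul (S.m + 3))).congr_deriv ?_
  simp only [quad₁]; push_cast; ring

theorem SolvesAt.hasDerivAt_quad₁ (h : S.SolvesAt t) :
    HasDerivAt S.quad₁ (-(S.w t * S.quad₂ t / t)) t := by
  refine ((((h.hX.pow 2).const_mul (2 * (S.m + 1) * (S.m - 1))).add
    ((h.hX.mul h.hY).const_mul (2 * (S.m + 1) * (2 * S.m + 3)))).add
    ((h.hY.pow 2).const_mul (2 * (S.m + 2) * (S.m + 3)))).congr_deriv ?_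
  simp only [quad₂]; push_cast; ring

end Profile

namespace IsNormalForm

variable {n : ℕ} {V : Set (Fin n → ℂ)} {g : (Fin n → ℂ) → Matrix (Fin n) (Fin n) ℂ}
  {S : Profile} (h : IsNormalForm V g S) {z : Fin n → ℂ} (hz : z ∈ V)
include h hz

theorem a2_eq : 24 * a2 g z =
    (S.cf * (3 * S.m + 5) * S.κ ^ 2 + S.cf * S.quad (nsq z) : ℝ) := by
  rw [a2_eq_of_scal_const h.isOpen (fun w hw => h.scal_eq hw) hz, h.normSqCurv_eq hz,
    h.normSqRic_eq hz]
  have := S.normR_sub_normRic (nsq z)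
  norm_cast
  rw [this]
  simp only [Profile.cf]; ring

theorem lap_normSq : lap g (fun w => normSqCurv g w - 4 * normSqRic g w + 8 * scal g w ^ 2) z =
    ((S.cf * (-(S.m * S.w (nsq z) * S.quad₁ (nsq z)) -
      S.y (nsq z) * (S.s (nsq z) - S.τ (nsq z)) * S.quad₁ (nsq z) +
      S.w (nsq z) * S.quad₂ (nsq z)) / S.y (nsq z) : ℝ) : ℂ) := by
  have hs := h.solves z hz
  have hx := hs.pos.ne'
  have hy := hs.y_pos.ne'
  have hw := hs.w_pos.ne'
  let c₀ : ℝ := -((S.m + 1) * (S.m + 2) * (4 * S.m + 6) * S.κ ^ 2) +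
    8 * ((S.m + 1) * (S.m + 2) * S.κ) ^ 2
  have e : (fun w => normSqCurv g w - 4 * normSqRic g w + 8 * scal g w ^ 2) =ᶠ[nhds z]
      fun w => ((c₀ + S.cf * S.quad (nsq w) : ℝ) : ℂ) := by
    filter_upwards [h.eventually_mem hz] with w hw
    have := S.normR_sub_normRic (nsq w)
    rw [h.normSqCurv_eq hw, h.normSqRic_eq hw, h.scal_eq hw]
    norm_cast
    rw [this]
    simp only [c₀]; ring
  rw [lap_congr e, h.lap_radial hz (f := fun t => c₀ + S.cf * S.quad t)
    (f₁ := fun t => S.cf * (-(S.w t * S.quad₁ t) / t ^ (0 + 1))) (f₂ := fun t =>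
      S.cf * (S.w t * (S.w t * S.quad₂ t - S.y t * (S.s t - S.τ t) * S.quad₁ t + S.quad₁ t)
        / t ^ 2))]
  · congr 1
    field_simp
    ring
  · intro w hw
    refine (((h.solves w hw).hasDerivAt_quad.const_mul S.cf).const_add c₀).congr_deriv ?_
    ring
  · refine ((hs.hasDerivAt_div_pow (hs.hasDerivAt_w.mul hs.hasDerivAt_quad₁).neg 0).const_mul
      S.cf).congr_deriv ?_
    simp only [Pi.neg_apply, Pi.mul_apply]
    field_simp
    push_cast
    ring

theorem a3_eq : 48 * a3 g z =
    (S.cf * (S.m + 1) * (S.m + 2) * (S.m - 1) * S.κ ^ 3 + S.cf * S.cubic (nsq z) : ℝ) := by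
  have hs := h.solves z hz
  have hy := hs.y_pos.ne'
  rw [a3_eq_of_scal_const h.isOpen (fun w hw => h.scal_eq hw) hz, h.lap_normSq hz,
    h.normSqCurv_eq hz, h.normSqRic_eq hz, h.ricDDCurv_eq hz, h.normSqDRic_eq hz,
    h.curvRicRic_eq hz, h.ricCurvCurv_eq hz]
  have e := S.normR_sub_normRic (nsq z)
  norm_cast
  rw [show ((S.m + 1) * (S.m + 2) * S.κ) ^ 2 - 4 * S.normRic (nsq z) + S.normR (nsq z) =
    ((S.m + 1) * (S.m + 2) * S.κ) ^ 2 + (S.normR (nsq z) - 4 * S.normRic (nsq z)) by ring, e]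
  simp only [Profile.ddR, Profile.normDRic, Profile.rRicRic, Profile.ricRR, Profile.cubic,
    Profile.cf, Profile.kA, Profile.kB, Profile.kC, Profile.quad, Profile.quad₁, Profile.quad₂,
    Profile.dB, Profile.dC, Profile.rP, Profile.rQ, Profile.τ, Profile.w, Profile.s]
  generalize nsq z = t at *
  field_simp
  ring

end IsNormalForm

/-! ### Constancy along a profile -/

namespace Profile

variable {S : Profile} {I : Set ℝ}

/-- The momentum coordinate is strictly increasing, so that `1 / y` takes infinitely many values. -/
theorem infinite_image_inv_y (hI : IsOpen I) (hc : IsPreconnected I) (hne : I.Nonempty)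
    (h : ∀ t ∈ I, S.SolvesAt t) : ((fun t => (S.y t)⁻¹) '' I).Infinite := by
  have hconv : Convex ℝ I := hc.ordConnected.convex
  have hmono : StrictMonoOn S.y I := by
    refine strictMonoOn_of_deriv_pos hconv
      (fun t ht => (h t ht).hy.continuousAt.continuousWithinAt) fun t ht => ?_
    rw [hI.interior_eq] at ht
    have := h t ht
    rw [this.hy.deriv]
    exact div_pos (mul_pos this.y_pos this.w_pos) this.pos
  refine Set.Infinite.image (fun a ha b hb hab => hmono.injOn ha hb (inv_injective hab)) ?_
  obtain ⟨t, ht⟩ := hne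
  exact infinite_of_mem_nhds t (hI.mem_nhds ht)

/-- A solution of `x f' = -k w f` is a multiple of `y ^ (-k)`, since `(f y ^ k)' = 0`. -/
theorem exists_first_integral (hI : IsOpen I) (hc : IsPreconnected I)
    (h : ∀ t ∈ I, S.SolvesAt t) {f : ℝ → ℝ} {k : ℕ}
    (hf : ∀ t ∈ I, HasDerivAt f (-((k : ℝ) * f t * S.w t / t)) t) :
    ∃ C, ∀ t ∈ I, f t = C * (S.y t)⁻¹ ^ k := by
  have hd : ∀ t ∈ I, HasDerivAt (fun r => f r * S.y r ^ k) 0 t := fun t ht => by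
    have hs := h t ht
    have hx := hs.pos.ne'
    refine ((hf t ht).mul (hs.hy.pow k)).congr_deriv ?_
    rcases k with _ | k
    · simp
    · simp only [Pi.pow_apply, Nat.add_sub_cancel, pow_succ]; ring
  obtain ⟨C, hC⟩ := hI.exists_is_const_of_deriv_eq_zero hc
    (fun t ht => (hd t ht).differentiableAt.differentiableWithinAt)
    (fun t ht => (hd t ht).deriv)
  refine ⟨C, fun t ht => ?_⟩
  have := (h t ht).y_pos.ne'
  rw [← hC t ht, inv_pow]
  field_simp

theorem coeff_eq_zero_of_eval_const {p : Polynomial ℝ} {T : Set ℝ} (hT : T.Infinite) {c : ℝ}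
    (hp : ∀ v ∈ T, p.eval v = c) {j : ℕ} (hj : j ≠ 0) : p.coeff j = 0 := by
  have : p = Polynomial.C c := Polynomial.eq_of_infinite_eval_eq _ _
    (hT.mono fun v hv => by simpa using hp v hv)
  rw [this, Polynomial.coeff_C, if_neg hj]

open Polynomial in
/-- Both coefficients are constant exactly when `Y = 0`, and `X = 0` or the dimension is two. -/
theorem quad_const_iff_cubic_const (hI : IsOpen I) (hc : IsPreconnected I) (hne : I.Nonempty)
    (h : ∀ t ∈ I, S.SolvesAt t) {k : ℕ} (hk : S.m = k) (hk1 : 1 ≤ k) :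
    (∃ c, ∀ t ∈ I, S.cubic t = c) ↔ ∃ c, ∀ t ∈ I, S.quad t = c := by
  have hinf := infinite_image_inv_y hI hc hne h
  obtain ⟨C, hC⟩ := exists_first_integral hI hc h (f := S.X) (k := k + 1) fun t ht => by
    have := (h t ht).hX
    rw [hk] at this; exact_mod_cast this
  obtain ⟨D, hD⟩ := exists_first_integral hI hc h (f := S.Y) (k := k + 2) fun t ht => by
    have := (h t ht).hY
    rw [hk] at this; exact_mod_cast this
  have hkpos : (0 : ℝ) < k := by exact_mod_cast hk1
  have good : D = 0 → (S.m - 1) * C = 0 → (∀ t ∈ I, S.cubic t = 0) ∧ ∀ t ∈ I, S.quad t = 0 := by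
    intro hD0 hC0
    have hY : ∀ t ∈ I, S.Y t = 0 := fun t ht => by rw [hD t ht, hD0, zero_mul]
    have hX : ∀ t ∈ I, (S.m - 1) * S.X t = 0 := fun t ht => by
      rw [hC t ht, ← mul_assoc, hC0, zero_mul]
    refine ⟨fun t ht => ?_, fun t ht => ?_⟩
    · simp only [cubic, hY t ht]
      linear_combination (2 * (S.m + 1) * (S.m + 3) * S.X t / S.y t -
        S.κ * (S.m + 1) * (S.m + 4) * S.X t +
        2 * (S.m + 1) * (2 * S.m + 3) * S.X t ^ 2) * hX t ht
    · simp only [quad, hY t ht]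
      linear_combination S.X t * hX t ht
  constructor
  · rintro ⟨c, hcub⟩
    have hD0 : D = 0 := by
      let p : ℝ[X] := Polynomial.C (2 * (S.m + 1) * (S.m + 3) * (S.m - 1) * C ^ 2) *
          Polynomial.X ^ (2 * k + 3)
        + Polynomial.C (4 * (S.m + 1) * (S.m + 2) * (S.m + 3) * C * D) * Polynomial.X ^ (2 * k + 4)
        + Polynomial.C (2 * (S.m + 2) * (S.m + 3) * (S.m + 4) * D ^ 2) * Polynomial.X ^ (2 * k + 5)
        - (Polynomial.C (S.κ * (S.m + 1) * (S.m + 4) * (S.m - 1) * C ^ 2) *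
            Polynomial.X ^ (2 * k + 2)
        + Polynomial.C (S.κ * (10 + 2 * S.m) * (S.m + 1) * (S.m + 2) * C * D) *
            Polynomial.X ^ (2 * k + 3)
        + Polynomial.C (S.κ * (S.m + 7) * (S.m + 2) * (S.m + 3) * D ^ 2) *
            Polynomial.X ^ (2 * k + 4))
        + Polynomial.C (2 * (S.m + 1) * (S.m - 1) * (2 * S.m + 3) * C ^ 3) *
            Polynomial.X ^ (3 * k + 3)
        + Polynomial.C (6 * (S.m + 1) ^ 2 * (2 * S.m + 3) * C ^ 2 * D) * Polynomial.X ^ (3 * k + 4)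
        + Polynomial.C ((42 + 42 * S.m + 12 * S.m ^ 2) * (S.m + 2) * C * D ^ 2) *
            Polynomial.X ^ (3 * k + 5)
        + Polynomial.C (2 * (S.m + 2) * (S.m + 3) * (2 * S.m + 5) * D ^ 3) *
            Polynomial.X ^ (3 * k + 6)
      have hp : ∀ v ∈ (fun t => (S.y t)⁻¹) '' I, p.eval v = c := by
        rintro _ ⟨t, ht, rfl⟩
        rw [← hcub t ht]
        simp only [p, cubic, hC t ht, hD t ht, div_eq_mul_inv, eval_add, eval_sub, eval_mul,
          eval_C, eval_pow, eval_X]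
        ring
      -- Only `Y³` contributes to the highest power.
      have := coeff_eq_zero_of_eval_const hinf hp (j := 3 * k + 6) (by omega)
      simp only [p, coeff_add, coeff_sub, coeff_C_mul_X_pow,
        show ¬ 3 * k + 6 = 2 * k + 2 by omega, show ¬ 3 * k + 6 = 2 * k + 3 by omega,
        show ¬ 3 * k + 6 = 2 * k + 4 by omega, show ¬ 3 * k + 6 = 2 * k + 5 by omega,
        show ¬ 3 * k + 6 = 3 * k + 3 by omega, show ¬ 3 * k + 6 = 3 * k + 4 by omega,
        show ¬ 3 * k + 6 = 3 * k + 5 by omega, if_true, if_false, hk] at this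
      have h3 : (0 : ℝ) < 2 * (k + 2) * (k + 3) * (2 * k + 5) := by positivity
      have h4 : 2 * ((k : ℝ) + 2) * (k + 3) * (2 * k + 5) * D ^ 3 = 0 := by linarith
      simpa using (mul_eq_zero.1 h4).resolve_left h3.ne'
    have hC0 : (S.m - 1) * C = 0 := by
      let p : ℝ[X] := Polynomial.C (2 * (S.m + 1) * (S.m + 3) * (S.m - 1) * C ^ 2) *
          Polynomial.X ^ (2 * k + 3)
        - Polynomial.C (S.κ * (S.m + 1) * (S.m + 4) * (S.m - 1) * C ^ 2) *
            Polynomial.X ^ (2 * k + 2)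
        + Polynomial.C (2 * (S.m + 1) * (S.m - 1) * (2 * S.m + 3) * C ^ 3) *
            Polynomial.X ^ (3 * k + 3)
      have hp : ∀ v ∈ (fun t => (S.y t)⁻¹) '' I, p.eval v = c := by
        rintro _ ⟨t, ht, rfl⟩
        rw [← hcub t ht]
        simp only [p, cubic, hC t ht, hD t ht, hD0, div_eq_mul_inv, eval_add, eval_sub, eval_mul,
          eval_C, eval_pow, eval_X]
        ring
      have := coeff_eq_zero_of_eval_const hinf hp (j := 3 * k + 3) (by omega)
      simp only [p, coeff_add, coeff_sub, coeff_C_mul_X_pow,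
        show ¬ 3 * k + 3 = 2 * k + 2 by omega, show ¬ 3 * k + 3 = 2 * k + 3 by omega,
        if_true, if_false, hk] at this
      have h3 : (0 : ℝ) < 2 * (k + 1) * (2 * k + 3) := by positivity
      have h4 : 2 * ((k : ℝ) + 1) * (2 * k + 3) * ((k - 1) * C ^ 3) = 0 := by linarith
      rw [hk]
      simpa using (mul_eq_zero.1 h4).resolve_left h3.ne'
    exact ⟨0, (good hD0 hC0).2⟩
  · rintro ⟨c, hq⟩
    let p : ℝ[X] := Polynomial.C ((S.m - 1) * C ^ 2) * Polynomial.X ^ (2 * k + 2)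
      + Polynomial.C (2 * (S.m + 1) * (C * D)) * Polynomial.X ^ (2 * k + 3)
      + Polynomial.C ((S.m + 3) * D ^ 2) * Polynomial.X ^ (2 * k + 4)
    have hp : ∀ v ∈ (fun t => (S.y t)⁻¹) '' I, p.eval v = c := by
      rintro _ ⟨t, ht, rfl⟩
      rw [← hq t ht]
      simp only [p, quad, hC t ht, hD t ht, eval_add, eval_mul,
        eval_C, eval_pow, eval_X]
      ring
    have h4 := coeff_eq_zero_of_eval_const hinf hp (j := 2 * k + 4) (by omega)
    have h2 := coeff_eq_zero_of_eval_const hinf hp (j := 2 * k + 2) (by omega)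
    simp only [p, coeff_add, coeff_C_mul_X_pow, Nat.add_left_cancel_iff, Nat.reduceEqDiff,
      if_true, if_false, zero_add, add_zero] at h4 h2
    have hm3 : (0 : ℝ) < S.m + 3 := by rw [hk]; positivity
    have hD0 : D = 0 := by simpa using (mul_eq_zero.1 h4).resolve_left hm3.ne'
    have hC0 : (S.m - 1) * C = 0 := by simpa using h2
    exact ⟨0, (good hD0 hC0).1⟩

end Profile

/-! ### Radial potentials -/

section Radial

variable {n : ℕ} {z : Fin n → ℂ}

theorem inv_form2 (hz : 0 < nsq z) {a b : ℂ} (ha : a ≠ 0) (hb : a + nsq z * b ≠ 0) :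
    (Matrix.of (form2 a b z))⁻¹ = (a + nsq z * b)⁻¹ • projP z + a⁻¹ • projQ z := by
  refine Matrix.inv_eq_right_inv ?_
  rw [form2_eq hz, (isProjPair hz).mul_lincomb, mul_inv_cancel₀ ha, mul_inv_cancel₀ hb, projQ]
  simp

/-- The matrix is a multiple of a rank one perturbation of the identity. -/
theorem det_form2 (z : Fin n → ℂ) {a b : ℂ} (ha : a ≠ 0) :
    (Matrix.of (form2 a b z)).det = a ^ n * (1 + nsq z * b / a) := by
  have e : Matrix.of (form2 a b z) = a • (1 + Matrix.replicateCol Unit (fun i => conj (z i)) *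
      Matrix.replicateRow Unit (fun j => b / a * z j)) := by
    ext i j
    simp only [form2, Matrix.of_apply, Matrix.smul_apply, Matrix.add_apply, Matrix.mul_apply,
      Matrix.replicateCol_apply, Matrix.replicateRow_apply, Finset.univ_unique,
      Finset.sum_singleton, smul_eq_mul]
    field_simp
  rw [e, Matrix.det_smul, Matrix.det_one_add_replicateCol_mul_replicateRow, Fintype.card_fin]
  have : (fun j => b / a * z j) ⬝ᵥ (fun i => conj (z i)) = nsq z * b / a := by
    rw [← sum_conj_mul_self, dotProduct, Finset.sum_mul, Finset.sum_div]
    exact Finset.sum_congr rfl fun _ _ => by ring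
  rw [this]

theorem form2_mulVec (a b : ℂ) (z v : Fin n → ℂ) (i : Fin n) :
    (Matrix.of (form2 a b z)).mulVec v i = a * v i + b * conj (z i) * ∑ j, z j * v j := by
  simp only [Matrix.mulVec, dotProduct, Matrix.of_apply, form2, add_mul, Finset.sum_add_distrib,
    Finset.mul_sum]
  congr 1
  · simp [Matrix.one_apply]
  · exact Finset.sum_congr rfl fun _ _ => by ring

theorem nsq_pos_iff : 0 < nsq z ↔ z ≠ 0 := by
  constructor
  · rintro h rfl; simp [nsq] at h
  · intro h
    obtain ⟨i, hi⟩ := Function.ne_iff.1 h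
    exact Finset.sum_pos' (fun _ _ => by positivity)
      ⟨i, Finset.mem_univ i, by have := norm_pos_iff.2 hi; positivity⟩

/-- The two eigenvalues of a positive definite radial matrix are positive. -/
theorem pos_of_posDef_form2 (hz : 0 < nsq z) (hn : 2 ≤ n) {a b : ℝ}
    (h : (Matrix.of (form2 a b z)).PosDef) : 0 < a ∧ 0 < a + nsq z * b := by
  constructor
  · -- A nonzero vector orthogonal to the radial direction.
    obtain ⟨i, hi⟩ := Function.ne_iff.1 (nsq_pos_iff.1 hz)
    obtain ⟨j, hj⟩ : ∃ j : Fin n, j ≠ i := by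
      have : Nontrivial (Fin n) := Fin.nontrivial_iff_two_le.2 hn
      exact exists_ne i
    let v : Fin n → ℂ := fun k => z i * (1 : Matrix (Fin n) (Fin n) ℂ) k j -
      z j * (1 : Matrix (Fin n) (Fin n) ℂ) k i
    have hv : v ≠ 0 := by
      intro h0
      have := congrFun h0 j
      simp [v, Matrix.one_apply_ne hj] at this
      exact hi this
    have hzv : ∑ k, z k * v k = 0 := by
      simp only [v, mul_sub, Finset.sum_sub_distrib, Matrix.one_apply]
      simp [mul_comm]
    have hpos := h.re_dotProduct_pos hv
    have e : star v ⬝ᵥ (Matrix.of (form2 a b z)).mulVec v = ((a * nsq v : ℝ) : ℂ) := by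
      simp only [dotProduct, form2_mulVec, hzv, mul_zero, add_zero, Pi.star_apply]
      push_cast
      rw [← sum_conj_mul_self, Finset.mul_sum]
      exact Finset.sum_congr rfl fun _ _ => by rw [Complex.star_def]; ring
    rw [e] at hpos
    exact pos_of_mul_pos_left (by simpa using hpos) (nsq_pos_iff.2 hv).le
  · let v : Fin n → ℂ := fun k => conj (z k)
    have hv : v ≠ 0 := by
      intro h0
      refine nsq_pos_iff.1 hz (funext fun k => ?_)
      have := congrFun h0 k
      simpa [v] using this
    have hzv : ∑ k, z k * v k = nsq z := by
      rw [← sum_conj_mul_self]; exact Finset.sum_congr rfl fun _ _ => mul_comm _ _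
    have hpos := h.re_dotProduct_pos hv
    have e : star v ⬝ᵥ (Matrix.of (form2 a b z)).mulVec v =
        (((a + nsq z * b) * nsq z : ℝ) : ℂ) := by
      simp only [dotProduct, form2_mulVec, hzv, Pi.star_apply]
      push_cast
      have : ∀ k, star (v k) * ((a : ℂ) * v k + b * conj (z k) * nsq z) =
          (a + nsq z * b) * (conj (z k) * z k) := fun k => by
        simp only [v, Complex.star_def, Complex.conj_conj]; ring
      rw [Finset.sum_congr rfl fun k _ => this k, ← Finset.mul_sum, sum_conj_mul_self]
    rw [e] at hpos
    exact pos_of_mul_pos_left (by simpa using hpos) hz.le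

/-- The mixed second derivatives of a radial function. -/
theorem dz_dzbar_radial {V : Set (Fin n → ℂ)} (hV : IsOpen V) (hz : z ∈ V) {f f₁ : ℝ → ℝ}
    {f₂ : ℝ} (hf : ∀ w ∈ V, HasDerivAt f (f₁ (nsq w)) (nsq w))
    (hf₁ : HasDerivAt f₁ f₂ (nsq z)) {u : (Fin n → ℂ) → ℂ} (hu : ∀ w ∈ V, u w = f (nsq w))
    (i j : Fin n) : dz i (dzbar j u) z = form2 (f₁ (nsq z)) f₂ z i j := by
  have e : dzbar j u =ᶠ[nhds z] fun w => f₁ (nsq w) * w j := by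
    filter_upwards [hV.mem_nhds hz] with w hw
    have : u =ᶠ[nhds w] fun w => (f (nsq w) : ℂ) := by
      filter_upwards [hV.mem_nhds hw] with v hv using hu v hv
    rw [dzbar_congr this]
    exact (HasWirtinger.radial (hf w hw)).dzbar_eq j
  rw [dz_congr e]
  refine (((HasWirtinger.radial hf₁).mul (HasWirtinger.coord j)).dz_eq i).trans ?_
  simp only [form2]; ring

theorem nsq_smul (r : ℝ) (z : Fin n → ℂ) : nsq ((r : ℂ) • z) = r ^ 2 * nsq z := by
  simp [nsq, mul_pow, Finset.mul_sum]

/-- The path through `z` along which `|z|²` is the parameter. -/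
def radialPath (z : Fin n → ℂ) (t : ℝ) : Fin n → ℂ := ((√(t / nsq z) : ℝ) : ℂ) • z

theorem nsq_radialPath (hz : 0 < nsq z) {t : ℝ} (ht : 0 ≤ t) : nsq (radialPath z t) = t := by
  rw [radialPath, nsq_smul, Real.sq_sqrt (div_nonneg ht hz.le)]
  field_simp

theorem radialPath_nsq (hz : 0 < nsq z) : radialPath z (nsq z) = z := by
  simp [radialPath, div_self hz.ne']

theorem contDiffAt_radialPath (hz : 0 < nsq z) : ContDiffAt ℝ ∞ (radialPath z) (nsq z) := by
  have h1 : ContDiffAt ℝ ∞ (fun t : ℝ => √(t / nsq z)) (nsq z) := by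
    refine ContDiffAt.sqrt (contDiffAt_id.div_const _) ?_
    simp [div_self hz.ne']
  have h2 : ContDiffAt ℝ ∞ (fun t : ℝ => ((√(t / nsq z) : ℝ) : ℂ)) (nsq z) :=
    Complex.ofRealCLM.contDiff.contDiffAt.comp _ h1
  exact h2.smul contDiffAt_const

theorem isOpen_nsq_image {V : Set (Fin n → ℂ)} (hV : IsOpen V) (h0 : ∀ z ∈ V, 0 < nsq z) :
    IsOpen (nsq '' V) := by
  rw [isOpen_iff_mem_nhds]
  rintro _ ⟨z, hz, rfl⟩
  have hc := (contDiffAt_radialPath (h0 z hz)).continuousAt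
  have h1 : ∀ᶠ t in nhds (nsq z), radialPath z t ∈ V :=
    hc (by rw [radialPath_nsq (h0 z hz)]; exact hV.mem_nhds hz)
  filter_upwards [h1, lt_mem_nhds (h0 z hz)] with t ht ht0
  exact ⟨_, ht, nsq_radialPath (h0 z hz) ht0.le⟩

/-- Away from the origin, a smooth radial function is a smooth function of `|z|²`: the latter is
its restriction to the smooth paths `radialPath z`. -/
theorem contDiffOn_of_radial {V : Set (Fin n → ℂ)} (hV : IsOpen V) (h0 : ∀ z ∈ V, 0 < nsq z)
    {F : (Fin n → ℂ) → ℝ} (hF : ContDiffOn ℝ ∞ F V) {f : ℝ → ℝ} (hf : ∀ z ∈ V, F z = f (nsq z)) :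
    ContDiffOn ℝ ∞ f (nsq '' V) := by
  rintro _ ⟨z, hz, rfl⟩
  have hc := contDiffAt_radialPath (h0 z hz)
  have h1 : ∀ᶠ t in nhds (nsq z), radialPath z t ∈ V :=
    hc.continuousAt (by rw [radialPath_nsq (h0 z hz)]; exact hV.mem_nhds hz)
  have h2 : ContDiffAt ℝ ∞ (fun t => F (radialPath z t)) (nsq z) := by
    refine ContDiffAt.comp (nsq z) ?_ hc
    rw [radialPath_nsq (h0 z hz)]
    exact hF.contDiffAt (hV.mem_nhds hz)
  refine (h2.congr_of_eventuallyEq ?_).contDiffWithinAt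
  filter_upwards [h1, lt_mem_nhds (h0 z hz)] with t ht ht0
  rw [hf _ ht, nsq_radialPath (h0 z hz) ht0.le]

theorem exists_derivs {f : ℝ → ℝ} {I : Set ℝ} (hI : IsOpen I) (hf : ContDiffOn ℝ ∞ f I) :
    ∃ f₁ : ℝ → ℝ, ContDiffOn ℝ ∞ f₁ I ∧ ∀ t ∈ I, HasDerivAt f (f₁ t) t := by
  obtain ⟨h1, h2⟩ := (contDiffOn_infty_iff_deriv_of_isOpen hI).1 hf
  exact ⟨deriv f, h2, fun t ht => (h1.differentiableAt (hI.mem_nhds ht)).hasDerivAt⟩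

end Radial

/-- A radial Kähler metric of constant scalar curvature in dimension at least two has the normal
form given by a profile. -/
theorem exists_isNormalForm {n : ℕ} (hn : 2 ≤ n) {V : Set (Fin n → ℂ)} (hV : IsOpen V)
    (hne : V.Nonempty) (h0 : ∀ z ∈ V, 0 < nsq z) {F : (Fin n → ℂ) → ℝ}
    (hF : IsKahlerPotentialOn V F) (hrad : IsRadialOn V F)
    (hscal : IsConstantOn V (scal (metric F))) :
    ∃ S : Profile, IsNormalForm V (metric F) S := by
  obtain ⟨f, hf⟩ := hrad
  obtain ⟨ρ, hρ⟩ := hscal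
  have hI := isOpen_nsq_image hV h0
  have hmem : ∀ z ∈ V, nsq z ∈ nsq '' V := fun z hz => ⟨z, hz, rfl⟩
  obtain ⟨f₁, hf₁, hd₁⟩ := exists_derivs hI (contDiffOn_of_radial hV h0 hF.1 hf)
  obtain ⟨f₂, hf₂, hd₂⟩ := exists_derivs hI hf₁
  obtain ⟨f₃, hf₃, hd₃⟩ := exists_derivs hI hf₂
  obtain ⟨f₄, -, hd₄⟩ := exists_derivs hI hf₃
  have hg : ∀ z ∈ V, ∀ i j, metric F z i j = form2 (f₁ (nsq z)) (f₂ (nsq z)) z i j :=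
    fun z hz i j => dz_dzbar_radial hV hz (fun w hw => hd₁ _ (hmem w hw)) (hd₂ _ (hmem z hz))
      (fun w hw => by rw [hf w hw]; rfl) i j
  have hg' : ∀ z ∈ V, metric F z = Matrix.of (form2 (f₁ (nsq z)) (f₂ (nsq z)) z) :=
    fun z hz => by ext i j; exact hg z hz i j
  have hpos : ∀ t ∈ nsq '' V, 0 < t ∧ 0 < f₁ t ∧ 0 < f₁ t + t * f₂ t := by
    rintro _ ⟨z, hz, rfl⟩
    have := hF.2 z hz
    rw [hg' z hz] at this
    exact ⟨h0 z hz, pos_of_posDef_form2 (h0 z hz) hn this⟩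
  have hn1 : (0 : ℝ) < n - 1 := by
    have : (2 : ℝ) ≤ n := by exact_mod_cast hn
    linarith
  obtain ⟨m, hm⟩ : ∃ m : ℝ, m = n - 1 := ⟨_, rfl⟩
  rw [← hm] at hn1
  -- `y` and `p` are the momentum coordinate and its logarithmic derivative, and `ℓ` is the
  -- logarithmic derivative of the determinant of the metric.
  let y : ℝ → ℝ := fun t => t * f₁ t
  let p : ℝ → ℝ := fun t => t * (f₁ t + t * f₂ t)
  let q : ℝ → ℝ := fun t => f₁ t + 3 * t * f₂ t + t ^ 2 * f₃ t
  let ℓ : ℝ → ℝ := fun t => m * (p t / y t) + t * q t / p t - (m + 1)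
  have hyp : ∀ t ∈ nsq '' V, 0 < t ∧ 0 < y t ∧ 0 < p t := fun t ht => by
    obtain ⟨h1, h2, h3⟩ := hpos t ht
    exact ⟨h1, mul_pos h1 h2, mul_pos h1 h3⟩
  have hy : ∀ t ∈ nsq '' V, HasDerivAt y (p t / t) t := fun t ht => by
    have ht0 := (hpos t ht).1.ne'
    refine ((hasDerivAt_id t).mul (hd₂ t ht)).congr_deriv ?_
    simp only [p, id]; field_simp
  have hp : ∀ t ∈ nsq '' V, HasDerivAt p (q t) t := fun t ht => by
    refine ((hasDerivAt_id t).mul ((hd₂ t ht).add ((hasDerivAt_id t).mul (hd₃ t ht)))).congr_deriv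
      ?_
    simp only [q, id, Pi.add_apply, Pi.mul_apply]; ring
  have hℓ' : ∀ t ∈ nsq '' V, ∃ d, HasDerivAt ℓ d t := fun t ht => by
    obtain ⟨-, h2, h3⟩ := hyp t ht
    have hq : HasDerivAt q _ t := ((hd₂ t ht).add (((hasDerivAt_id t).const_mul 3).mul
      (hd₃ t ht))).add (((hasDerivAt_id t).pow 2).mul (hd₄ t ht))
    exact ⟨_, ((((hp t ht).div (hy t ht) h2.ne').const_mul m).add
      (((hasDerivAt_id t).mul hq).div (hp t ht) h3.ne')).sub_const (m + 1)⟩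
  choose! ℓ₁ hℓ using hℓ'
  -- As `log det g` is radial with derivative `ℓ / x`, the Ricci tensor is its negative Hessian.
  have hric : ∀ z ∈ V, ∀ i j, ric (metric F) i j z =
      form2 ((-(ℓ (nsq z) / nsq z) : ℝ) : ℂ)
        ((-((nsq z * ℓ₁ (nsq z) - ℓ (nsq z)) / nsq z ^ 2) : ℝ) : ℂ) z i j := by
    intro z hz i j
    have hdet : ∀ w ∈ V, Complex.log (metric F w).det =
        ((m * Real.log (f₁ (nsq w)) + Real.log (f₁ (nsq w) + nsq w * f₂ (nsq w)) : ℝ) : ℂ) := by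
      intro w hw
      obtain ⟨h1, h2, h3⟩ := hpos _ (hmem w hw)
      have ha : (f₁ (nsq w) : ℂ) ≠ 0 := by exact_mod_cast h2.ne'
      rw [hg' w hw, det_form2 w ha]
      have e : (f₁ (nsq w) : ℂ) ^ n * (1 + nsq w * f₂ (nsq w) / f₁ (nsq w)) =
          ((f₁ (nsq w) ^ n * ((f₁ (nsq w) + nsq w * f₂ (nsq w)) / f₁ (nsq w)) : ℝ) : ℂ) := by
        push_cast; field_simp
      rw [e, ← Complex.ofReal_log (by positivity), Real.log_mul (by positivity) (by positivity),
        Real.log_pow, Real.log_div h3.ne' h2.ne', hm]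
      congr 1; ring
    have hL : ∀ t ∈ nsq '' V, HasDerivAt (fun t => m * Real.log (f₁ t) +
        Real.log (f₁ t + t * f₂ t)) (ℓ t / t) t := fun t ht => by
      obtain ⟨h1, h2, h3⟩ := hpos t ht
      refine (((hd₂ t ht).log h2.ne').const_mul m |>.add (((hd₂ t ht).add
        ((hasDerivAt_id t).mul (hd₃ t ht))).log h3.ne')).congr_deriv ?_
      simp only [ℓ, p, q, y, id, Pi.add_apply, Pi.mul_apply]
      obtain ⟨P, hP⟩ : ∃ P, P = f₁ t + t * f₂ t := ⟨_, rfl⟩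
      rw [← hP] at h3 ⊢
      have h1' := h1.ne'; have h2' := h2.ne'; have h3' := h3.ne'
      rw [show f₂ t = (P - f₁ t) / t by rw [hP]; field_simp; ring]
      field_simp
      ring
    have hL1 : HasDerivAt (fun t => ℓ t / t) ((nsq z * ℓ₁ (nsq z) - ℓ (nsq z)) / nsq z ^ 2)
        (nsq z) := by
      refine ((hℓ _ (hmem z hz)).div (hasDerivAt_id _) (h0 z hz).ne').congr_deriv ?_
      simp only [id]; ring
    rw [ric, dz_dzbar_radial hV hz (fun w hw => hL _ (hmem w hw)) hL1 hdet]
    simp only [form2]; push_cast; ring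
  -- The trace of `Ric g⁻¹`; its two terms are the radial and the transversal eigenvalues.
  have hscal : ∀ z ∈ V, scal (metric F) z =
      ((-(nsq z * ℓ₁ (nsq z) / p (nsq z)) - m * (ℓ (nsq z) / y (nsq z)) : ℝ) : ℂ) := by
    intro z hz
    obtain ⟨h1, h2, h3⟩ := hpos _ (hmem z hz)
    have e : scal (metric F) z = (Matrix.of (form2 ((-(ℓ (nsq z) / nsq z) : ℝ) : ℂ)
        ((-((nsq z * ℓ₁ (nsq z) - ℓ (nsq z)) / nsq z ^ 2) : ℝ) : ℂ) z) * (metric F z)⁻¹).trace := by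
      simp only [scal, ginv, Matrix.trace, Matrix.diag, Matrix.mul_apply, Matrix.of_apply,
        hric z hz]
      exact Finset.sum_congr rfl fun _ _ => Finset.sum_congr rfl fun _ _ => mul_comm _ _
    have ha : (f₁ (nsq z) : ℂ) ≠ 0 := by exact_mod_cast h2.ne'
    have hb : (f₁ (nsq z) : ℂ) + nsq z * f₂ (nsq z) ≠ 0 := by exact_mod_cast h3.ne'
    rw [e, hg' z hz, inv_form2 h1 ha hb, form2_eq h1, (isProjPair h1).mul_lincomb,
      (isProjPair h1).trace_lincomb]
    have hm' : (n : ℂ) - 1 = m := by rw [hm]; push_cast; rfl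
    rw [hm']
    norm_cast
    simp only [p, y]
    have := h1.ne'; have := h2.ne'; have := h3.ne'
    field_simp
    ring
  obtain ⟨r, hr⟩ : ∃ r : ℝ, ∀ t ∈ nsq '' V, -(t * ℓ₁ t / p t) - m * (ℓ t / y t) = r := by
    obtain ⟨z₀, hz₀⟩ := hne
    refine ⟨-(nsq z₀ * ℓ₁ (nsq z₀) / p (nsq z₀)) - m * (ℓ (nsq z₀) / y (nsq z₀)), ?_⟩
    rintro _ ⟨z, hz, rfl⟩
    have := (hscal z hz).symm.trans ((hρ z hz).trans ((hρ z₀ hz₀).symm.trans (hscal z₀ hz₀)))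
    exact_mod_cast this
  have hm1 : m + 1 ≠ 0 := by positivity
  have hm2 : m + 2 ≠ 0 := by positivity
  obtain ⟨κ, hκ⟩ : ∃ κ, κ = r / ((m + 1) * (m + 2)) := ⟨_, rfl⟩
  have hκr : (m + 1) * ((m + 2) * κ) = r := by rw [hκ]; field_simp
  have hℓeq : ∀ t ∈ nsq '' V, ℓ₁ t = -(p t / t * ((m + 1) * ((m + 2) * κ) + m * (ℓ t / y t))) :=
    fun t ht => by
      obtain ⟨h1, h2, h3⟩ := hyp t ht
      rw [hκr, ← hr t ht]
      have := h1.ne'; have := h2.ne'; have := h3.ne'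
      field_simp
      ring
  -- The transversal Ricci eigenvalue `-ℓ / y` determines `X`, and `s = X + Y - κ` determines `Y`.
  -- Constancy of the scalar curvature is the equation for `X`; together with the definition of
  -- `ℓ` it gives the equation for `Y`.
  let S : Profile := ⟨κ, m, y, fun t => (m + 2) * κ + ℓ t / y t,
    fun t => p t / y t ^ 2 - 1 / y t + κ - ((m + 2) * κ + ℓ t / y t)⟩
  have hs : ∀ t, S.s t = p t / y t ^ 2 - 1 / y t := fun t => by
    simp only [Profile.s, S]; ring
  have hw : ∀ t ∈ nsq '' V, S.w t = p t / y t := fun t ht => by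
    have := (hyp t ht).2.1.ne'
    rw [Profile.w, hs]
    change 1 + y t * (p t / y t ^ 2 - 1 / y t) = _
    field_simp
    ring
  have hX : ∀ t ∈ nsq '' V, HasDerivAt S.X (-((m + 1) * S.X t * S.w t / t)) t := fun t ht => by
    obtain ⟨h1, h2, h3⟩ := hyp t ht
    refine (((hℓ t ht).div (hy t ht) h2.ne').const_add ((m + 2) * κ)).congr_deriv ?_
    rw [hℓeq t ht, hw t ht]
    simp only [S]
    have := h1.ne'; have := h2.ne'
    field_simp
    ring
  have hq : ∀ t ∈ nsq '' V, q t = p t / t * (ℓ t + (m + 1) - m * (p t / y t)) := fun t ht => by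
    obtain ⟨h1, h2, h3⟩ := hyp t ht
    have := h1.ne'; have := h2.ne'; have := h3.ne'
    simp only [ℓ]
    field_simp
    ring
  refine ⟨S, hV, by simp only [S]; rw [hm]; ring, fun z hz => ?_, fun z hz i j => ?_,
    fun z hz i j => ?_⟩
  · have ht := hmem z hz
    generalize nsq z = t at *
    obtain ⟨h1, h2, h3⟩ := hyp t ht
    have h1' := h1.ne'; have h2' := h2.ne'
    refine ⟨h1, h2, by rw [hw t ht]; exact div_pos h3 h2, ?_, hX t ht, ?_⟩
    · rw [hw t ht]
      refine (hy t ht).congr_deriv ?_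
      simp only [S]; field_simp
    · have d1 : HasDerivAt (fun t => p t / y t ^ 2 - 1 / y t + κ - S.X t) _ t :=
        (((((hp t ht).div ((hy t ht).pow 2) (pow_ne_zero 2 h2')).sub
          ((hasDerivAt_const t (1 : ℝ)).div (hy t ht) h2')).add_const κ).sub (hX t ht))
      refine d1.congr_deriv ?_
      rw [hw t ht, hq t ht]
      simp only [S, Pi.pow_apply]
      field_simp
      ring
  · have h1 := (hpos _ (hmem z hz)).1.ne'
    have h2 := (hpos _ (hmem z hz)).2.1.ne'
    rw [hg z hz]
    have ea : S.a (nsq z) = f₁ (nsq z) := by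
      simp only [Profile.a, S, y]; field_simp
    have eb : S.b (nsq z) = f₂ (nsq z) := by
      rw [Profile.b, hs]
      simp only [S, y, p]; field_simp; ring
    rw [ea, eb]
  · obtain ⟨h1, h2, h3⟩ := hyp _ (hmem z hz)
    have h1' := h1.ne'; have h2' := h2.ne'; have h3' := h3.ne'
    rw [hric z hz]
    have ec : S.c (nsq z) = -(ℓ (nsq z) / nsq z) := by
      simp only [Profile.c, Profile.rQ, S]; field_simp; ring
    have ee : S.e (nsq z) = -((nsq z * ℓ₁ (nsq z) - ℓ (nsq z)) / nsq z ^ 2) := by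
      rw [Profile.e, hw _ (hmem z hz), hℓeq _ (hmem z hz)]
      simp only [Profile.rQ, Profile.rP, S]; field_simp; ring
    rw [ec, ee]

/-! ### Smoothness -/

section Smooth

variable {n : ℕ} {U : Set (Fin n → ℂ)}

/-- Smoothness of complex-valued functions on `U`, in the real sense. -/
abbrev SmoothOn (U : Set (Fin n → ℂ)) (f : (Fin n → ℂ) → ℂ) : Prop := ContDiffOn ℝ ∞ f U

theorem SmoothOn.dz {f : (Fin n → ℂ) → ℂ} (hU : IsOpen U) (hf : SmoothOn U f) (i : Fin n) :
    SmoothOn U (dz i f) := by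
  have h : ContDiffOn ℝ ∞ (fderiv ℝ f) U := hf.fderiv_of_isOpen hU (by simp)
  exact contDiffOn_const.mul ((h.clm_apply contDiffOn_const).sub
    (contDiffOn_const.mul (h.clm_apply contDiffOn_const)))

theorem SmoothOn.dzbar {f : (Fin n → ℂ) → ℂ} (hU : IsOpen U) (hf : SmoothOn U f) (i : Fin n) :
    SmoothOn U (dzbar i f) := by
  have h : ContDiffOn ℝ ∞ (fderiv ℝ f) U := hf.fderiv_of_isOpen hU (by simp)
  exact contDiffOn_const.mul ((h.clm_apply contDiffOn_const).add
    (contDiffOn_const.mul (h.clm_apply contDiffOn_const)))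

theorem SmoothOn.conj {f : (Fin n → ℂ) → ℂ} (hf : SmoothOn U f) :
    SmoothOn U (fun z => conj (f z)) :=
  (Complex.conjCLE : ℂ →L[ℝ] ℂ).contDiff.comp_contDiffOn hf

theorem SmoothOn.sum {ι : Type*} [Fintype ι] {f : ι → (Fin n → ℂ) → ℂ}
    (hf : ∀ i, SmoothOn U (f i)) : SmoothOn U (fun z => ∑ i, f i z) :=
  ContDiffOn.sum fun i _ => hf i

theorem SmoothOn.det {g : (Fin n → ℂ) → Matrix (Fin n) (Fin n) ℂ}
    (hg : ∀ i j, SmoothOn U (fun z => g z i j)) : SmoothOn U (fun z => (g z).det) := by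
  simp only [Matrix.det_apply']
  exact SmoothOn.sum fun σ => contDiffOn_const.mul (contDiffOn_prod fun i _ => hg _ _)

variable {g : (Fin n → ℂ) → Matrix (Fin n) (Fin n) ℂ}

theorem smoothOn_ginv (hg : ∀ i j, SmoothOn U (fun z => g z i j))
    (hdet : ∀ z ∈ U, (g z).det ≠ 0) (i j : Fin n) : SmoothOn U (ginv g i j) := by
  have e : ginv g i j = fun z => (g z).det⁻¹ * ((g z).updateRow i (Pi.single j 1)).det := by
    funext z
    rw [ginv, Matrix.inv_def, Matrix.smul_apply, Matrix.adjugate_apply, Ring.inverse_eq_inv',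
      smul_eq_mul]
  rw [e]
  refine ((SmoothOn.det hg).inv hdet).mul (SmoothOn.det fun k l => ?_)
  by_cases hk : k = i
  · subst hk; simp only [Matrix.updateRow_self]; exact contDiffOn_const
  · simp only [Matrix.updateRow_ne hk]; exact hg k l

/-- The coefficients `a₂` and `a₃` of a smooth metric are smooth. -/
theorem smoothOn_a2_a3 (hU : IsOpen U) (hg : ∀ i j, SmoothOn U (fun z => g z i j))
    (hdet : ∀ z ∈ U, (g z).det ∈ Complex.slitPlane) :
    SmoothOn U (a2 g) ∧ SmoothOn U (a3 g) := by
  have hinv : ∀ i j, SmoothOn U (ginv g i j) :=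
    smoothOn_ginv hg fun z hz => Complex.slitPlane_ne_zero (hdet z hz)
  have hlog : SmoothOn U (fun z => Complex.log (g z).det) := fun z hz =>
    ContDiffAt.comp_contDiffWithinAt (g := Complex.log) z
      ((Complex.contDiffAt_log (hdet z hz)).restrict_scalars ℝ) (SmoothOn.det hg z hz)
  have hric : ∀ i j, SmoothOn U (ric g i j) := fun i j => ((hlog.dzbar hU j).dz hU i).neg
  have hscal : SmoothOn U (scal g) := .sum fun i => .sum fun j => (hinv i j).mul (hric i j)
  have hlap : ∀ u, SmoothOn U u → SmoothOn U (lap g u) := fun u hu =>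
    .sum fun i => .sum fun j => (hinv i j).mul ((hu.dzbar hU j).dz hU i)
  have hchr : ∀ k i p, SmoothOn U (christoffel g k i p) := fun k i p =>
    .sum fun q => (hinv p q).mul ((hg i q).dz hU k)
  have hcurv : ∀ i j k l, SmoothOn U (curv g i j k l) := fun i j k l =>
    (((hg i l).dzbar hU j).dz hU k).sub (SmoothOn.sum fun p => SmoothOn.sum fun q =>
      ((hinv q p).mul ((hg i p).dz hU k)).mul ((hg q l).dzbar hU j))
  have hricD : ∀ i j k, SmoothOn U (ricD g i j k) := fun i j k =>
    ((hric i j).dz hU k).sub (SmoothOn.sum fun p => (hchr k i p).mul (hric p j))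
  have hricDD : ∀ i j k l, SmoothOn U (ricDD g i j k l) := fun i j k l =>
    ((hricD i j k).dzbar hU l).sub (SmoothOn.sum fun p => (hchr l j p).conj.mul (hricD i p k))
  have hnR : SmoothOn U (normSqCurv g) :=
    .sum fun i => .sum fun j => .sum fun k => .sum fun l => .sum fun a => .sum fun b =>
      .sum fun c => .sum fun d => (((((hinv i a).mul (hinv b j)).mul (hinv k c)).mul
        (hinv d l)).mul (hcurv i j k l)).mul (hcurv a b c d).conj
  have hnRic : SmoothOn U (normSqRic g) :=
    .sum fun i => .sum fun j => .sum fun a => .sum fun b =>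
      (((hinv i a).mul (hinv b j)).mul (hric i j)).mul (hric a b).conj
  have hnD : SmoothOn U (normSqDScal g) :=
    .sum fun i => .sum fun j => ((hinv i j).mul (hscal.dz hU i)).mul (hscal.dzbar hU j)
  have hnDR : SmoothOn U (normSqDRic g) :=
    .sum fun i => .sum fun j => .sum fun k => .sum fun a => .sum fun b =>
      .sum fun c => ((((hinv i a).mul (hinv b j)).mul (hinv k c)).mul
        (hricD i j k)).mul (hricD a b c).conj
  have hH : SmoothOn U (ricHessScal g) :=
    .sum fun i => .sum fun j => .sum fun a => .sum fun b =>
      (((hinv i b).mul (hinv a j)).mul (hric i j)).mul ((hscal.dzbar hU b).dz hU a)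
  have hσ : SmoothOn U (sigma3 g) :=
    .sum fun i => .sum fun j => .sum fun a => .sum fun b =>
      .sum fun c => .sum fun d => (((((hinv i d).mul (hinv a j)).mul (hinv c b)).mul
        (hric i j)).mul (hric a b)).mul (hric c d)
  have hRR : SmoothOn U (curvRicRic g) :=
    .sum fun i => .sum fun j => .sum fun k => .sum fun l => .sum fun a => .sum fun b =>
      .sum fun c => .sum fun d => ((((((hinv i a).mul (hinv b j)).mul (hinv k c)).mul
        (hinv d l)).mul (hcurv i j k l)).mul (hric b a)).mul (hric d c)
  have hRicRR : SmoothOn U (ricCurvCurv g) :=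
    .sum fun i => .sum fun j => .sum fun k => .sum fun p => .sum fun q => .sum fun a =>
      .sum fun b => .sum fun c => .sum fun d => .sum fun e =>
        (((((((hinv i a).mul (hinv b j)).mul (hinv k c)).mul (hinv p d)).mul (hinv e q)).mul
          (hric i j)).mul (hcurv b c p q)).mul (hcurv k a e d)
  have hDD : SmoothOn U (ricDDCurv g) :=
    .sum fun i => .sum fun j => .sum fun k => .sum fun l => .sum fun a => .sum fun b =>
      .sum fun c => .sum fun d => (((((hinv i a).mul (hinv b j)).mul (hinv k c)).mul
        (hinv d l)).mul (hricDD i j k l)).mul (hcurv b a d c)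
  have hdd1 : SmoothOn U (divdivScalRic g) :=
    ((contDiffOn_const.mul hnD).add hH).add (hscal.mul (hlap _ hscal))
  have hdd2 : SmoothOn U (divdivCurvRic g) :=
    (((hH.neg.sub (contDiffOn_const.mul hnDR)).add hDD).sub hRR).sub hσ
  have c {c : ℂ} {f : (Fin n → ℂ) → ℂ} (hf : SmoothOn U f) : SmoothOn U (fun z => c * f z) :=
    contDiffOn_const.mul hf
  refine ⟨(c (hlap _ hscal)).add (c ((hnR.sub (c hnRic)).add (c (hscal.pow 2)))), ?_⟩
  exact (((((c (hlap _ (hlap _ hscal))).add (c hdd2)).sub (c hdd1)).add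
    (c (hlap _ ((hnR.sub (c hnRic)).add (c (hscal.pow 2)))))).add
    ((c hscal).mul (((hscal.pow 2).sub (c hnRic)).add hnR))).add (c ((hσ.sub hRicRR).sub hRR))

theorem smoothOn_metric (hU : IsOpen U) {F : (Fin n → ℂ) → ℝ} (hF : ContDiffOn ℝ ∞ F U)
    (i j : Fin n) : SmoothOn U (fun z => metric F z i j) := by
  have h : SmoothOn U (fun z => (F z : ℂ)) := Complex.ofRealCLM.contDiff.comp_contDiffOn hF
  exact (h.dzbar hU j).dz hU i

theorem det_mem_slitPlane {M : Matrix (Fin n) (Fin n) ℂ} (hM : M.PosDef) :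
    M.det ∈ Complex.slitPlane := by
  have := hM.det_pos
  rw [Complex.lt_def] at this
  exact Or.inl this.1

end Smooth

/-! ### Complex dimension one -/

/-- Chain rule for a holomorphic function of a complex-valued function. -/
theorem HasWirtinger.comp_holomorphic {n : ℕ} {f : (Fin n → ℂ) → ℂ} {p q : Fin n → ℂ}
    {z : Fin n → ℂ} {φ : ℂ → ℂ} {φ' : ℂ} (hf : HasWirtinger f p q z)
    (hφ : HasDerivAt φ φ' (f z)) :
    HasWirtinger (fun w => φ (f w)) (fun i => φ' * p i) (fun i => φ' * q i) z := by
  have key : HasFDerivAt (fun w => φ (f w)) (φ' • fderiv ℝ f z) z := by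
    have h1 := (hφ.hasFDerivAt.restrictScalars ℝ).comp z hf.1.hasFDerivAt
    refine h1.congr_fderiv ?_
    ext v; simp [mul_comm]
  refine ⟨key.differentiableAt, fun i => ?_, fun i => ?_⟩
  · rw [← hf.2]; simp only [TYZ.dz, key.fderiv, smul_apply, smul_eq_mul]; ring
  · rw [← hf.3]; simp only [TYZ.dzbar, key.fderiv, smul_apply, smul_eq_mul]; ring

theorem hasWirtinger_of_differentiableAt {n : ℕ} {f : (Fin n → ℂ) → ℂ} {z : Fin n → ℂ}
    (hf : DifferentiableAt ℝ f z) :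
    HasWirtinger f (fun i => dz i f z) (fun i => dzbar i f z) z :=
  ⟨hf, fun _ => rfl, fun _ => rfl⟩

/-- In complex dimension one, both coefficients are constant if the scalar curvature is. -/
theorem const_of_dim_one {U : Set (Fin 1 → ℂ)} (hU : IsOpen U)
    {g : (Fin 1 → ℂ) → Matrix (Fin 1) (Fin 1) ℂ} (hg : ∀ i j, SmoothOn U (fun z => g z i j))
    (hpos : ∀ z ∈ U, (g z).PosDef) (hs : IsConstantOn U (scal g)) :
    IsConstantOn U (a2 g) ∧ IsConstantOn U (a3 g) := by
  obtain ⟨c, hc⟩ := hs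
  have hdet : ∀ z, (g z).det = g z 0 0 := fun z => Matrix.det_fin_one _
  -- The logarithm in the Ricci tensor is differentiated on its domain of holomorphy.
  have hslit : ∀ z ∈ U, g z 0 0 ∈ Complex.slitPlane := fun z hz => by
    rw [← hdet]; exact det_mem_slitPlane (hpos z hz)
  have h0 : ∀ z ∈ U, g z 0 0 ≠ 0 := fun z hz => Complex.slitPlane_ne_zero (hslit z hz)
  have hconj : ∀ z ∈ U, conj (g z 0 0) = g z 0 0 := fun z hz => (hpos z hz).isHermitian.apply 0 0
  have hinv : ∀ z, ginv g 0 0 z = (g z 0 0)⁻¹ := fun z => by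
    rw [ginv, Matrix.inv_def, hdet, Ring.inverse_eq_inv', Matrix.adjugate_fin_one]
    simp
  have hW : ∀ {f : (Fin 1 → ℂ) → ℂ}, SmoothOn U f → ∀ z ∈ U,
      HasWirtinger f (fun i => dz i f z) (fun i => dzbar i f z) z := fun hf z hz =>
    hasWirtinger_of_differentiableAt
      ((hf.contDiffAt (hU.mem_nhds hz)).differentiableAt (by simp))
  have hG := hg 0 0
  have hric : ∀ z ∈ U, ric g 0 0 z = c * g z 0 0 := fun z hz => by
    have := hc z hz
    simp only [scal, Fin.sum_univ_one, Fin.isValue, hinv] at this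
    rw [← this]; have := h0 z hz; field_simp
  have hcurv : ∀ z ∈ U, curv g 0 0 0 0 z = -(c * g z 0 0 ^ 2) := fun z hz => by
    have e1 : dzbar 0 (fun w => Complex.log (g w).det) =ᶠ[nhds z]
        fun w => (g w 0 0)⁻¹ * dzbar 0 (fun v => g v 0 0) w := by
      filter_upwards [hU.mem_nhds hz] with w hw
      simp only [hdet]
      exact ((hW hG w hw).comp_holomorphic (Complex.hasDerivAt_log (hslit w hw))).dzbar_eq 0
    have e2 := (((hW hG z hz).comp_holomorphic (hasDerivAt_inv (h0 z hz))).mul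
      (hW (hG.dzbar hU 0) z hz)).dz_eq 0
    have e3 := hric z hz
    rw [ric, dz_congr e1, e2] at e3
    simp only [curv, Fin.sum_univ_one, Fin.isValue, hinv]
    have := h0 z hz
    field_simp at e3 ⊢
    linear_combination -e3
  have hricD : ∀ z ∈ U, ricD g 0 0 0 z = 0 := fun z hz => by
    have e1 : ric g 0 0 =ᶠ[nhds z] fun w => c * g w 0 0 := by
      filter_upwards [hU.mem_nhds hz] with w hw using hric w hw
    have e2 := ((HasWirtinger.const c).mul (hW hG z hz)).dz_eq 0
    simp only [ricD, christoffel, Fin.sum_univ_one, Fin.isValue, hinv]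
    rw [dz_congr e1, e2, hric z hz]
    have := h0 z hz
    field_simp
    ring
  have hricDD : ∀ z ∈ U, ricDD g 0 0 0 0 z = 0 := fun z hz => by
    simp only [ricDD, Fin.sum_univ_one, Fin.isValue, hricD z hz, mul_zero, sub_zero]
    exact dzbar_eq_zero_of_const hU hricD hz 0
  have hnR : ∀ z ∈ U, normSqCurv g z = c * conj c := fun z hz => by
    simp only [normSqCurv, Fin.sum_univ_one, Fin.isValue, hinv, hcurv z hz, map_neg, map_mul,
      map_pow, hconj z hz]
    have := h0 z hz
    field_simp
  have hnRic : ∀ z ∈ U, normSqRic g z = c * conj c := fun z hz => by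
    simp only [normSqRic, Fin.sum_univ_one, Fin.isValue, hinv, hric z hz, map_mul, hconj z hz]
    have := h0 z hz
    field_simp
  have hnD : ∀ z ∈ U, normSqDRic g z = 0 := fun z hz => by
    simp only [normSqDRic, Fin.sum_univ_one, Fin.isValue, hricD z hz, mul_zero, zero_mul]
  have hDD : ∀ z ∈ U, ricDDCurv g z = 0 := fun z hz => by
    simp only [ricDDCurv, Fin.sum_univ_one, Fin.isValue, hricDD z hz, mul_zero, zero_mul]
  have hRR : ∀ z ∈ U, curvRicRic g z = -c ^ 3 := fun z hz => by
    simp only [curvRicRic, Fin.sum_univ_one, Fin.isValue, hinv, hric z hz, hcurv z hz]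
    have := h0 z hz
    field_simp
  have hRicRR : ∀ z ∈ U, ricCurvCurv g z = c ^ 3 := fun z hz => by
    simp only [ricCurvCurv, Fin.sum_univ_one, Fin.isValue, hinv, hric z hz, hcurv z hz]
    have := h0 z hz
    field_simp
  refine ⟨⟨1 / 24 * (c * conj c - 4 * (c * conj c) + 3 * c ^ 2), fun z hz => ?_⟩,
    ⟨1 / 48 * (2 * c ^ 3 + c * (c ^ 2 - 4 * (c * conj c) + c * conj c)), fun z hz => ?_⟩⟩
  · have := a2_eq_of_scal_const hU hc hz
    rw [hnR z hz, hnRic z hz] at this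
    linear_combination 1 / 24 * this
  · have := a3_eq_of_scal_const hU hc hz
    have e : ∀ w ∈ U, normSqCurv g w - 4 * normSqRic g w + 8 * scal g w ^ 2 =
        c * conj c - 4 * (c * conj c) + 8 * c ^ 2 := fun w hw => by
      rw [hnR w hw, hnRic w hw, hc w hw]
    rw [hnR z hz, hnRic z hz, hnD z hz, hDD z hz, hRR z hz, hRicRR z hz,
      lap_eq_zero_of_const g hU e hz] at this
    linear_combination 1 / 48 * this

/-! ### Constancy of the two coefficients -/

section Final

variable {n : ℕ} {U V : Set (Fin n → ℂ)}

/-- Constancy of a continuous function can be tested on a dense subset. -/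
theorem isConstantOn_iff_of_dense {u : (Fin n → ℂ) → ℂ} (hVU : V ⊆ U) (hUV : U ⊆ closure V)
    (hu : ContinuousOn u U) : IsConstantOn U u ↔ IsConstantOn V u := by
  constructor
  · rintro ⟨c, hc⟩; exact ⟨c, fun z hz => hc z (hVU hz)⟩
  · rintro ⟨c, hc⟩
    exact ⟨c, Set.EqOn.of_subset_closure (s := V) (t := U) (g := fun _ => c)
      (fun z hz => hc z hz) hu continuousOn_const hVU hUV⟩

theorem isConstantOn_iff_radial {u : (Fin n → ℂ) → ℂ} (hne : V.Nonempty) {A B k : ℝ} (hB : B ≠ 0)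
    (hk : k ≠ 0) {q : ℝ → ℝ} (hu : ∀ z ∈ V, (k : ℂ) * u z = (A + B * q (nsq z) : ℝ)) :
    IsConstantOn V u ↔ ∃ c, ∀ t ∈ nsq '' V, q t = c := by
  have hk' : (k : ℂ) ≠ 0 := by exact_mod_cast hk
  constructor
  · rintro ⟨c, hc⟩
    obtain ⟨z₀, hz₀⟩ := hne
    refine ⟨q (nsq z₀), ?_⟩
    rintro _ ⟨z, hz, rfl⟩
    have e : ((A + B * q (nsq z) : ℝ) : ℂ) = (A + B * q (nsq z₀) : ℝ) := by
      rw [← hu z hz, ← hu z₀ hz₀, hc z hz, hc z₀ hz₀]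
    have e' : A + B * q (nsq z) = A + B * q (nsq z₀) := by exact_mod_cast e
    exact mul_left_cancel₀ hB (add_left_cancel e')
  · rintro ⟨c, hc⟩
    refine ⟨(k : ℂ)⁻¹ * (A + B * c : ℝ), fun z hz => ?_⟩
    rw [← hc _ ⟨z, hz, rfl⟩, ← hu z hz, inv_mul_cancel_left₀ hk']

/-- The positive values of `|z|²` on a preconnected set form an interval. -/
theorem isPreconnected_nsq_image_inter (hU : IsPreconnected U) :
    IsPreconnected (nsq '' (U ∩ {z | 0 < nsq z})) := by
  have hc : Continuous (nsq (n := n)) := by unfold nsq; fun_prop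
  have e : nsq '' (U ∩ {z | 0 < nsq z}) = nsq '' U ∩ Set.Ioi 0 := by
    ext t
    constructor
    · rintro ⟨z, ⟨hz, h0⟩, rfl⟩; exact ⟨⟨z, hz, rfl⟩, h0⟩
    · rintro ⟨⟨z, hz, rfl⟩, h0⟩; exact ⟨z, ⟨hz, h0⟩, rfl⟩
  rw [e]
  exact ((hU.image _ hc.continuousOn).ordConnected.inter Set.ordConnected_Ioi).isPreconnected

end Final

end
end TYZ

theorem theorem1p1 (n : ℕ) (U : Set (Fin n → ℂ)) (hU : IsOpen U) (hconn : IsConnected U)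
    (F : (Fin n → ℂ) → ℝ) (hF : TYZ.IsKahlerPotentialOn U F) (hrad : TYZ.IsRadialOn U F)
    (hscal : TYZ.IsConstantOn U (TYZ.scal (TYZ.metric F))) :
    TYZ.IsConstantOn U (TYZ.a3 (TYZ.metric F)) ↔
      TYZ.IsConstantOn U (TYZ.a2 (TYZ.metric F)) := by
  obtain rfl | rfl | hn : n = 0 ∨ n = 1 ∨ 2 ≤ n := by omega
  · exact iff_of_true ⟨_, fun z _ => congrArg _ (Subsingleton.elim z 0)⟩
      ⟨_, fun z _ => congrArg _ (Subsingleton.elim z 0)⟩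
  · have := TYZ.const_of_dim_one hU (TYZ.smoothOn_metric hU hF.1) hF.2 hscal
    exact iff_of_true this.2 this.1
  · have : Nontrivial (Fin n → ℂ) := by
      have : NeZero n := ⟨by omega⟩
      infer_instance
    have hset : {z : Fin n → ℂ | 0 < TYZ.nsq z} = {0}ᶜ := by
      ext z; exact TYZ.nsq_pos_iff
    have hdense : Dense {z : Fin n → ℂ | 0 < TYZ.nsq z} := by
      have : Filter.NeBot (nhdsWithin (0 : Fin n → ℂ) {0}ᶜ) :=
        Module.punctured_nhds_neBot ℂ (Fin n → ℂ) 0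
      rw [hset]; exact dense_compl_singleton 0
    -- The punctured domain, on which the normal form is available.
    let V := U ∩ {z : Fin n → ℂ | 0 < TYZ.nsq z}
    have hVU : V ⊆ U := Set.inter_subset_left
    have hV : IsOpen V := hU.inter (by rw [hset]; exact isOpen_compl_singleton)
    have hUV : U ⊆ closure V := hdense.open_subset_closure_inter hU
    have hne : V.Nonempty := hdense.inter_open_nonempty U hU hconn.nonempty
    have h0 : ∀ z ∈ V, 0 < TYZ.nsq z := fun z hz => hz.2
    obtain ⟨f, hf⟩ := hrad
    obtain ⟨c, hc⟩ := hscal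
    obtain ⟨S, hS⟩ := TYZ.exists_isNormalForm hn hV hne h0
      (F := F) ⟨hF.1.mono hVU, fun z hz => hF.2 z (hVU hz)⟩ ⟨f, fun z hz => hf z (hVU hz)⟩
      ⟨c, fun z hz => hc z (hVU hz)⟩
    obtain ⟨h2, h3⟩ := TYZ.smoothOn_a2_a3 hU (TYZ.smoothOn_metric hU hF.1)
      fun z hz => TYZ.det_mem_slitPlane (hF.2 z hz)
    have hm : S.m = ((n - 1 : ℕ) : ℝ) := by
      have := hS.card
      rw [Nat.cast_sub (by omega), this]; simp
    have hmpos : 0 < S.m := by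
      rw [hm]; exact_mod_cast (by omega : 0 < n - 1)
    have hcf : S.cf ≠ 0 := by unfold TYZ.Profile.cf; positivity
    rw [TYZ.isConstantOn_iff_of_dense hVU hUV h3.continuousOn,
      TYZ.isConstantOn_iff_of_dense hVU hUV h2.continuousOn,
      TYZ.isConstantOn_iff_radial hne hcf (k := 48) (by norm_num)
        (fun z hz => by exact_mod_cast hS.a3_eq hz),
      TYZ.isConstantOn_iff_radial hne hcf (k := 24) (by norm_num)
        (fun z hz => by exact_mod_cast hS.a2_eq hz)]
    refine TYZ.Profile.quad_const_iff_cubic_const (TYZ.isOpen_nsq_image hV h0)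
      (TYZ.isPreconnected_nsq_image_inter hconn.isPreconnected) (hne.image _) ?_ hm (by omega)
    rintro _ ⟨z, hz, rfl⟩
    exact hS.solves z hz
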